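/- Let $k$ be a finite field and let $X$ be a smooth projective geometrically integral variety of dimension $r$ over $k$. Let $\mathcal P=(P_1,\dots,P_n)$ be distinct $k$-rational points of $X$, let $\mathcal D=\{D_1,\dots,D_r\}$ be effective divisors on $X$ over $k$ that intersect properly (i.e. $\bigcap_\ell D_\ell$ is a finite set of points) with $\mathcal P\subseteq\bigcap_\ell D_\ell$, and let $G$ be a divisor on $X$ over $k$ with $\mathrm{Supp}(G)\cap\mathcal P=\emptyset$. For $P\in\bigcap_\ell D_\ell$ let $\mathbf x=(x_1,\dots,x_r)$ generate the maximal ideal of $\mathcal O_P$, let $f_1,\dots,f_r\in\mathcal O_P$ be local equations of $D_1,\dots,D_r$ at $P$, choose $a>0$ and $r_{ij}\in\mathcal O_P$ with $x_i^a=\sum_j r_{ij}f_j$, and put $R_P=\det(r_{ij})$. If $P$ is $k$-rational and $\omega$ is a rational $r$-form on $X$ with $f_1\cdots f_r\,\omega=h\,dx_1\wedge\cdots\wedge dx_r$, $h\in\mathcal O_P$, then $\mathrm{Res}_P[\omega;D_1,\dots,D_r]\in k$ denotes the coefficient of $x_1^{a-1}\cdots x_r^{a-1}$ in the power series expansion of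 $R_P h$ in $\mathbf x$. (This does not depend on the choices.) A rational function $\theta\in k(X)$ is called strictly $(\mathcal D,\mathcal P)$-rectifying if it is regular at every point of $\bigcap_\ell D_\ell$, if for each $P\in\mathcal P$ there is $c_P\in k$, $c_P\ne0$, with $R_P\theta\equiv c_P\,x_1^{a-1}\cdots x_r^{a-1}\pmod{(x_1^a,\dots,x_r^a)}$, and if $R_P\theta\equiv0\pmod{(x_1^a,\dots,x_r^a)}$ for each point $P\in\bigcap_\ell D_\ell$ outside $\mathcal P$. (Neither does this depend on the choices.) For a divisor $A$ let $L(A)$ be the space of rational functions $f$ with $f=0$ or $(f)+A\ge0$, let $\Omega^r(A)$ be the space of rational $r$-forms $\omega$ with $\omega=0$ or $(\omega)+A\ge0$, and write $A^+$ and $A^-$ for the positive and negative parts of $A=A^+-A^-$. For a strictly $(\mathcal D,\mathcal P)$-rectifying function $\theta^s$, the strictly rectified differential code $C_\Omega(\mathcal D,\mathcal P,\theta^s,G)\subseteq k^n$ is the image of $$\Omega^r\Bigl(\sum_\ell D_\ell-G-(\theta^s)^+\Bigr)\to k^n,\qquad \omega\mapsto\bigl(\mathrm{Res}_{P_i}[\omega;D_1,\dots,D_r]\bigr)_{1\le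 i\le n},$$ and for a divisor $A$ with $\mathrm{Supp}(A)\cap\mathcal P=\emptyset$ the functional code $C_L(\mathcal P,A)\subseteq k^n$ is the image of $L(A)\to k^n$, $f\mapsto(f(P_1),\dots,f(P_n))$. Theorem. Let $\theta^s$ be strictly $(\mathcal D,\mathcal P)$-rectifying. Then $C_\Omega(\mathcal D,\mathcal P,\theta^s,G)$ is functional, that is, equal to $C_L(\mathcal P,G')$ for some divisor $G'$ over $k$ whose support is disjoint from $\mathcal P$. More precisely, for every open set $U\subseteq X$ containing $\mathcal P$ (for instance one on which each $D_\ell$ is defined by some $f_\ell\in k[U]$) there are an open set $V$ with $\mathcal P\subseteq V\subseteq U$ and a nonzero rational $r$-form $\eta$ on $X$ over $k$ whose divisor on $V$ is $-\sum_\ell D_\ell\cap V$, such that a) $\mathrm{Res}_P[\theta^s\eta;D_1,\dots,D_r]=1$ for all $P\in\mathcal P$, and b) the support of $\sum_\ell D_\ell-G+(\eta)-(\theta^s)^-$ is disjoint from $\mathcal P$, and $$C_\Omega(\mathcal D,\mathcal P,\theta^s,G)=C_L\Bigl(\mathcal P,\ \sum_\ell D_\ell-G+(\eta)-(\theta^s)^-\Bigr).$$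 -/

import Mathlib

open CategoryTheory AlgebraicGeometry

universe u

noncomputable section

namespace RectifiedCode

/-! ## Projective varieties over a field -/

section Projective

variable (k : Type u) [Field k]

/-- The homogeneous polynomials over `k` in `N + 1` variables, graded by degree. -/
abbrev homogeneousPolys (N : ℕ) : ℕ → Submodule k (MvPolynomial (Fin (N + 1)) k) :=
  MvPolynomial.homogeneousSubmodule (Fin (N + 1)) k

instance (N : ℕ) : GradedAlgebra (homogeneousPolys k N) :=
  MvPolynomial.gradedAlgebra

/-- The structure morphism of the projective `N`-space `Proj k[T₀, …, T_N]` over `k`. -/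
def projSpaceToSpec (N : ℕ) : Proj (homogeneousPolys k N) ⟶ Spec (CommRingCat.of k) :=
  Proj.toSpecZero (homogeneousPolys k N) ≫
    Spec.map (CommRingCat.ofHom (algebraMap k (homogeneousPolys k N 0)))

/-- A `k`-scheme is projective if it is isomorphic over `k` to a closed subscheme of some
projective space over `k`. -/
def IsProjective (X : Scheme.{u}) [X.Over (Spec (CommRingCat.of k))] : Prop :=
  ∃ (N : ℕ) (i : X ⟶ Proj (homogeneousPolys k N)),
    IsClosedImmersion i ∧ i ≫ projSpaceToSpec k N = X ↘ Spec (CommRingCat.of k)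

end Projective

/-! ## Local rings, rational points, values -/

section Local

/-- The structure map `k → 𝒪_{X,P}` of a `k`-scheme. -/
def structureMap (k : Type u) [Field k] (X : Scheme.{u}) [X.Over (Spec (CommRingCat.of k))]
    (P : X) : k →+* X.presheaf.stalk P :=
  ((Scheme.ΓSpecIso (CommRingCat.of k)).inv ≫ (X ↘ Spec (CommRingCat.of k)).appTop ≫
    X.presheaf.germ ⊤ P trivial).hom

/-- The local rings of a `k`-scheme are `k`-algebras. As the function field is the local ring at
the generic point, this also makes the function field a `k`-algebra. -/
instance stalkAlgebra (k : Type u) [Field k] (X : Scheme.{u})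
    [X.Over (Spec (CommRingCat.of k))] (P : X) : Algebra k (X.presheaf.stalk P) :=
  (structureMap k X P).toAlgebra

/-- `P` is a `k`-rational point: its residue field is `k`. -/
def IsRationalPoint (k : Type u) [Field k] {X : Scheme.{u}}
    [X.Over (Spec (CommRingCat.of k))] (P : X) : Prop :=
  Function.Bijective
    ((IsLocalRing.residue (X.presheaf.stalk P)).comp (algebraMap k (X.presheaf.stalk P)))

variable {X : Scheme.{u}} [IsIntegral X]

/-- The inclusion of the local ring `𝒪_{X,P}` in the function field. -/
abbrev toFun (P : X) : X.presheaf.stalk P →+* X.functionField :=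
  algebraMap (X.presheaf.stalk P) X.functionField

/-- The rational function `f` is regular at `P`. -/
def IsRegularAt (P : X) (f : X.functionField) : Prop :=
  ∃ g : X.presheaf.stalk P, toFun P g = f

open Classical in
/-- The value `f(P) ∈ k` of a rational function that is regular at the `k`-rational point `P`: the
element of `k` to which `f` is congruent modulo the maximal ideal of `𝒪_{X,P}` (and `0` if there
is none). -/
def evalAt (k : Type u) [Field k] [X.Over (Spec (CommRingCat.of k))] (P : X)
    (f : X.functionField) : k :=
  if H : ∃ c : k, ∃ g : X.presheaf.stalk P, toFun P g = f ∧
      g - algebraMap k (X.presheaf.stalk P) c ∈ IsLocalRing.maximalIdeal (X.presheaf.stalk P)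
  then H.choose else 0

end Local

/-! ## Divisors -/

section Divisors

/-- A prime divisor, given by its generic point, a point of codimension one. -/
abbrev PrimeDivisor (X : Scheme.{u}) : Type u := {z : X // Order.coheight z = 1}

/-- Divisors: finite formal integer combinations of prime divisors. -/
abbrev WeilDivisor (X : Scheme.{u}) : Type u := PrimeDivisor X →₀ ℤ

/-- The support of a divisor: the union of the prime divisors that occur in it. -/
def supp {X : Scheme.{u}} (D : WeilDivisor X) : Set X :=
  {P | ∃ Y : PrimeDivisor X, D Y ≠ 0 ∧ P ∈ closure {Y.1}}

variable {X : Scheme.{u}} [IsIntegral X] [IsLocallyNoetherian X]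

/-- The coefficients of the divisor `(f)` of a rational function `f`. -/
def divFun (f : X.functionField) : PrimeDivisor X → ℤ := fun Y => X.ord f Y.1

/-- `f` is a local equation of `D` at `P`: the divisors `(f)` and `D` agree along every prime
divisor through `P`. -/
def IsLocalEquation (D : WeilDivisor X) (P : X) (f : X.functionField) : Prop :=
  f ≠ 0 ∧ ∀ Y : PrimeDivisor X, P ∈ closure {Y.1} → divFun f Y = D Y

/-- The space `L(A)` of rational functions `f` with `f = 0` or `(f) + A ≥ 0`. -/
def LSpace (A : PrimeDivisor X → ℤ) : Set X.functionField :=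
  {f | f = 0 ∨ 0 ≤ divFun f + A}

end Divisors

/-! ## Rational differential forms -/

section Forms

variable (k : Type u) [Field k] (X : Scheme.{u}) [IsIntegral X]
  [X.Over (Spec (CommRingCat.of k))] (r : ℕ)

/-- The rational `r`-forms on `X` over `k`: the `r`-th exterior power, over the function field, of
its Kähler differentials over `k`. -/
abbrev RatForm : Type u := ⋀[X.functionField]^r (Ω[X.functionField⁄k])

variable {k X r}

variable (k) in
/-- The form `dx₁ ∧ ⋯ ∧ dx_r`. -/
def dWedge (x : Fin r → X.functionField) : RatForm k X r :=
  exteriorPower.ιMulti X.functionField r fun i => KaehlerDifferential.D k X.functionField (x i)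

variable (k r) in
/-- The `r`-forms that are regular at `P`: sums of forms `a db₁ ∧ ⋯ ∧ db_r` with
`a, b₁, …, b_r ∈ 𝒪_{X,P}`. -/
def regularForms (P : X) : AddSubgroup (RatForm k X r) :=
  AddSubgroup.closure {ω | ∃ (a : X.presheaf.stalk P) (b : Fin r → X.presheaf.stalk P),
    ω = toFun P a • dWedge k fun i => toFun P (b i)}

/-- `ω₀` generates the `𝒪_{X,P}`-module of `r`-forms regular at `P`. -/
def IsGenerator (P : X) (ω₀ : RatForm k X r) : Prop :=
  ∀ ω : RatForm k X r, ω ∈ regularForms k r P ↔ ∃ a : X.presheaf.stalk P, ω = toFun P a • ω₀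

variable [IsLocallyNoetherian X]

open Classical in
/-- The coefficients of the divisor `(ω)` of a nonzero rational `r`-form on a smooth `r`-dimensional
variety: along a prime divisor `Y` write `ω = h ω₀`, where `ω₀` generates the forms regular at the
generic point of `Y`, and take the order of `h` along `Y`. The generator is unique up to a unit, so
its choice does not matter. -/
def divForm (ω : RatForm k X r) : PrimeDivisor X → ℤ := fun Y =>
  if H : ∃ h : X.functionField, ∃ ω₀ : RatForm k X r, IsGenerator Y.1 ω₀ ∧ ω = h • ω₀
  then X.ord H.choose Y.1 else 0

variable (k r) in
/-- The space `Ω^r(A)` of rational `r`-forms `ω` with `ω = 0` or `(ω) + A ≥ 0`. -/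
def OmegaSpace (A : PrimeDivisor X → ℤ) : Set (RatForm k X r) :=
  {ω | ω = 0 ∨ 0 ≤ divForm ω + A}

end Forms

/-! ## Grothendieck residues at rational points -/

section Residues

variable {k : Type u} [Field k] {X : Scheme.{u}} [IsIntegral X] [IsLocallyNoetherian X]
  [X.Over (Spec (CommRingCat.of k))] {r : ℕ}

/-- The family `c` gives the power series expansion `h = ∑_I c_I x^I` of the element `h` of
`𝒪_{X,P}`: for each `N`, `h` is congruent modulo the `N`-th power of the maximal ideal to the sum
of the terms with all exponents less than `N` (each other term lies in that power). -/
def IsExpansion {P : X} (x : Fin r → X.presheaf.stalk P) (h : X.presheaf.stalk P)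
    (c : (Fin r → ℕ) → k) : Prop :=
  ∀ N : ℕ, h - ∑ I ∈ Fintype.piFinset (fun _ : Fin r => Finset.range N),
      algebraMap k (X.presheaf.stalk P) (c I) * ∏ j, x j ^ I j
    ∈ IsLocalRing.maximalIdeal (X.presheaf.stalk P) ^ N

variable (k) in
open Classical in
/-- The coefficient of `x^I` in the power series expansion of `h ∈ 𝒪_{X,P}`, for generators
`x₁, …, x_r` of the maximal ideal of the `r`-dimensional regular local ring of a rational point. -/
def expansionCoeff {P : X} (x : Fin r → X.presheaf.stalk P) (h : X.presheaf.stalk P)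
    (I : Fin r → ℕ) : k :=
  if H : ∃ c : (Fin r → ℕ) → k, IsExpansion x h c then H.choose I else 0

/-- The auxiliary choices at a point `P` from which residues relative to `D₁, …, D_r` are computed:
generators `x_i` of the maximal ideal, local equations `f_j` of the `D_j`, an exponent `a > 0` and
a matrix `(r_ij)` over `𝒪_{X,P}` with `x_i ^ a = ∑_j r_ij f_j`. -/
structure LocalData (D : Fin r → WeilDivisor X) (P : X) where
  x : Fin r → X.presheaf.stalk P
  span_x : Ideal.span (Set.range x) = IsLocalRing.maximalIdeal (X.presheaf.stalk P)
  f : Fin r → X.presheaf.stalk P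
  isLocalEquation_f : ∀ j, IsLocalEquation (D j) P (toFun P (f j))
  a : ℕ
  a_pos : 0 < a
  M : Matrix (Fin r) (Fin r) (X.presheaf.stalk P)
  x_pow : ∀ i, x i ^ a = ∑ j, M i j * f j

namespace LocalData

variable {D : Fin r → WeilDivisor X} {P : X} (L : LocalData D P)

/-- The determinant `R_P(x, f, a) = det (r_ij)`. -/
def R : X.presheaf.stalk P := L.M.det

/-- The ideal `(x₁ ^ a, …, x_r ^ a)`. -/
def powIdeal : Ideal (X.presheaf.stalk P) := Ideal.span (Set.range fun i => L.x i ^ L.a)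

/-- The monomial `x₁ ^ (a - 1) ⋯ x_r ^ (a - 1)`. -/
def socle : X.presheaf.stalk P := ∏ i, L.x i ^ (L.a - 1)

open Classical in
/-- The residue at the rational point `P` of a form `ω` for which `f₁ ⋯ f_r ω` is regular at `P`,
computed from the given choices: if `f₁ ⋯ f_r ω = h dx₁ ∧ ⋯ ∧ dx_r`, it is the coefficient of
`x₁ ^ (a - 1) ⋯ x_r ^ (a - 1)` in the expansion of `R_P(x, f, a) h`. -/
def residue (ω : RatForm k X r) : k :=
  if H : ∃ h : X.presheaf.stalk P,
      toFun P (∏ j, L.f j) • ω = toFun P h • dWedge k fun i => toFun P (L.x i)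
  then expansionCoeff k L.x (L.R * H.choose) (fun _ => L.a - 1) else 0

end LocalData

/-- The local data fixed at `P` once and for all. Neither residues nor the notion of a rectifying
function depend on this choice, and local data exist at each closed point of a smooth variety. -/
def fixedData (D : Fin r → WeilDivisor X) (P : X) (H : Nonempty (LocalData D P)) :
    LocalData D P := H.some

open Classical in
/-- The residue `Res_P [ω; D₁, …, D_r]` at a rational point of `⋂ D_l`. -/
def res (D : Fin r → WeilDivisor X) (P : X) (ω : RatForm k X r) : k :=
  if H : Nonempty (LocalData D P) then (fixedData D P H).residue ω else 0

end Residues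

/-! ## Rectifying functions and the codes -/

section Codes

variable (k : Type u) [Field k] {X : Scheme.{u}} [IsIntegral X] [IsLocallyNoetherian X]
  [X.Over (Spec (CommRingCat.of k))] {r n : ℕ}

/-- The set-theoretic intersection `D₁ ∩ ⋯ ∩ D_r`. -/
def interSupp (D : Fin r → WeilDivisor X) : Set X := ⋂ l, supp (D l)

/-- The rational function `θ` is regular at `P` and satisfies
`R_P(x, f, a) θ ≡ c x₁ ^ (a - 1) ⋯ x_r ^ (a - 1)` modulo `(x₁ ^ a, …, x_r ^ a)`. -/
def RectifyingCongr (D : Fin r → WeilDivisor X) (P : X) (θ : X.functionField) (c : k) : Prop :=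
  ∃ t : X.presheaf.stalk P, toFun P t = θ ∧ ∃ H : Nonempty (LocalData D P),
    (fixedData D P H).R * t
        - algebraMap k (X.presheaf.stalk P) c * (fixedData D P H).socle
      ∈ (fixedData D P H).powIdeal

/-- `θ` is strictly `(𝒟, 𝒫)`-rectifying: it is regular at every point of `⋂ D_l`, the congruence
holds with a nonzero constant at each point of `𝒫`, and it holds with the constant `0` at the other
points of `⋂ D_l`, which need not be rational. -/
structure IsStrictlyRectifying (D : Fin r → WeilDivisor X) (P : Fin n → X)
    (θ : X.functionField) : Prop where
  regular : ∀ p ∈ interSupp D, IsRegularAt p θ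
  congr_mem : ∀ i, ∃ c : k, c ≠ 0 ∧ RectifyingCongr k D (P i) θ c
  congr_notMem : ∀ p ∈ interSupp D, p ∉ Set.range P → RectifyingCongr k D p θ 0

/-- The functional code `C_L(𝒫, A)`: the image of the evaluation map `L(A) → k^n`. -/
def functionalCode (P : Fin n → X) (A : PrimeDivisor X → ℤ) : Set (Fin n → k) :=
  (fun f i => evalAt k (P i) f) '' LSpace A

/-- The rectified differential code `C_Ω(𝒟, 𝒫, θ, G)`: the image of the residue map
`Ω^r(∑ D_l - G - (θ)⁺) → k^n`. -/
def differentialCode (D : Fin r → WeilDivisor X) (P : Fin n → X) (θ : X.functionField)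
    (G : WeilDivisor X) : Set (Fin n → k) :=
  (fun (ω : RatForm k X r) i => res D (P i) ω) ''
    OmegaSpace k r (fun Y => ∑ l, D l Y - G Y - (divFun θ Y)⁺)

end Codes

end RectifiedCode

end

/-!
The idea is to find one rational form `η` such that `f ↦ f θ η` identifies the functional code with
the differential code.

Residues are computed at a rational point `P` with coordinates `x` and local equations `f_l` of the
divisors. If `R_P θ` is congruent to `c x₁ ^ (a - 1) ⋯ x_r ^ (a - 1)` modulo `(x₁ ^ a, …, x_r ^ a)`
and `u` is regular at `P`, then `(f₁ ⋯ f_r)⁻¹ u θ dx₁ ∧ ⋯ ∧ dx_r` has residue `c u(P)`, since the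
monomial `x₁ ^ (a - 1) ⋯ x_r ^ (a - 1)` times the maximal ideal lies in `(x₁ ^ a, …, x_r ^ a)`
(`LocalData.residue_eq`). This rests on existence and uniqueness of power series expansions at
rational points of a smooth variety (`exists_expansion`, `coeff_expansion_eq`), obtained from the
infinitesimal lifting property over the polynomial ring.

So near `P_i` the form `η` has to be `u_i (f₁ ⋯ f_r)⁻¹ dx₁ ∧ ⋯ ∧ dx_r` with a unit `u_i` whose value
at `P_i` is `c_i⁻¹`. Relative to a fixed rational form this prescribes `η` at each `P_i` by a
rational function up to units, and two of these functions have the same order, namely that of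
`-∑ D_l`, along any prime divisor through both points. Such local data are glued on an affine open
set containing all `P_i` (`IsProjective.exists_isAffineOpen`): there are sections that do not
vanish at one point but clear the poles, and introduce zeros, at the others
(`exists_isUnit_germ_mul_mem_maximalIdeal`, `exists_unit_mul_eq`). The resulting form (`exists_form`)
has divisor `-∑ D_l` along all but finitely many prime divisors, none of which passes through a
point `P_i`; removing these gives `V`.

Finally every rational form is `f θ η` for a rational function `f`, the conditions on the divisors
of `f θ η` and of `f` correspond, and the divisor `A` that occurs has no component through any
`P_i`. Hence each `f` in `L(A)` is regular at `P_i` by the Hartogs property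
(`isRegularAt_of_forall_divFun_nonneg`), and the residue of `f θ η` at `P_i` is `f(P_i)`. The Hartogs
property holds because smooth varieties are normal, being locally étale over an affine space
(`isIntegrallyClosed_of_etale`, `exists_notMem_smul_mem_of_height_one`).

If `θ = 0`, then there are no points `P_i`, and both codes are the single point of `k ^ 0`.
-/

noncomputable section

namespace RectifiedCode

/-! ### Normality of smooth algebras and the Hartogs property -/

open TensorProduct in
/-- Étale algebras over normal domains are normal, as far as they are domains: integral closures
commute with smooth base change, and `B ⊗ Frac A` is the fraction field of `B`. -/
theorem isIntegrallyClosed_of_etale (A B : Type u) [CommRing A] [IsDomain A]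
    [IsIntegrallyClosed A] [CommRing B] [IsDomain B] [Algebra A B] [Algebra.Etale A B] :
    IsIntegrallyClosed B := by
  let F := FractionRing A
  let L := FractionRing B
  have hinj : Function.Injective (algebraMap A B) := by
    rw [injective_iff_map_eq_zero]
    intro a ha
    have h0 : a • (1 : B) = 0 := by rw [Algebra.smul_def, ha, zero_mul]
    simpa using h0
  have : FaithfulSMul A B := (faithfulSMul_iff_algebraMap_injective A B).mpr hinj
  let : Algebra F L := FractionRing.liftAlgebra A L
  let ψ : (B ⊗[A] F) →ₐ[B] L := Algebra.TensorProduct.lift (Algebra.ofId B L)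
    (IsScalarTower.toAlgHom A F L) (fun _ _ => Commute.all _ _)
  -- Every element of `B ⊗ Frac A` has a multiple by a nonzero element of `A` that lies in `B`.
  have hden : ∀ z : (B ⊗[A] F), ∃ a : A, a ≠ 0 ∧ ∃ b : B, a • z = b ⊗ₜ (1 : F) := by
    intro z
    induction z using TensorProduct.induction_on with
    | zero => exact ⟨1, one_ne_zero, 0, by simp⟩
    | tmul b f =>
      obtain ⟨x, y, hy, rfl⟩ := IsFractionRing.div_surjective (A := A) f
      refine ⟨y, nonZeroDivisors.ne_zero hy, x • b, ?_⟩
      have hy' : algebraMap A F y ≠ 0 := by simpa using nonZeroDivisors.ne_zero hy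
      rw [← TensorProduct.tmul_smul, TensorProduct.smul_tmul, Algebra.smul_def, Algebra.smul_def]
      congr 1
      rw [mul_div_cancel₀ _ hy', mul_one]
    | add z w hz hw =>
      obtain ⟨a, ha, b, hb⟩ := hz
      obtain ⟨a', ha', b', hb'⟩ := hw
      refine ⟨a * a', mul_ne_zero ha ha', a' • b + a • b', ?_⟩
      rw [smul_add, mul_comm a a', mul_smul, hb, mul_comm a' a, mul_smul, hb',
        TensorProduct.add_tmul, TensorProduct.smul_tmul', TensorProduct.smul_tmul']
  have hsmul : ∀ (a : A) (z : (B ⊗[A] F)), a ≠ 0 → a • z = 0 → z = 0 := by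
    intro a z ha hz
    have : (1 ⊗ₜ[A] (algebraMap A F a)⁻¹ : (B ⊗[A] F)) * (a • z) = z := by
      have h1 : a • z = (1 ⊗ₜ[A] (algebraMap A F a) : (B ⊗[A] F)) * z := by
        rw [Algebra.algebraMap_eq_smul_one, TensorProduct.tmul_smul,
          ← Algebra.TensorProduct.one_def, smul_mul_assoc, one_mul]
      rw [h1, ← mul_assoc, Algebra.TensorProduct.tmul_mul_tmul, inv_mul_cancel₀ (by simpa using ha),
        one_mul, ← Algebra.TensorProduct.one_def, one_mul]
    rw [← this, hz, mul_zero]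
  have hψ : Function.Injective ψ := by
    rw [injective_iff_map_eq_zero]
    intro z hz
    obtain ⟨a, ha, b, hb⟩ := hden z
    refine hsmul a z ha ?_
    have h1 : ψ (b ⊗ₜ (1 : F)) = 0 := by
      rw [← hb, ← algebraMap_smul B a z, map_smul, hz, smul_zero]
    have h2 : algebraMap B L b = 0 := by
      rw [Algebra.TensorProduct.lift_tmul, map_one, mul_one] at h1
      exact h1
    rw [hb, (map_eq_zero_iff _ (IsFractionRing.injective B L)).mp h2, TensorProduct.zero_tmul]
  have : IsDomain (B ⊗[A] F) := hψ.isDomain ψ.toRingHom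
  have hfin : (algebraMap F (F ⊗[A] B)).Finite := by
    have : Module.Finite F (F ⊗[A] B) := Algebra.FormallyUnramified.finite_of_free _ _
    exact RingHom.finite_algebraMap.mpr this
  let e : (F ⊗[A] B) ≃+* (B ⊗[A] F) := (Algebra.TensorProduct.comm A F B).toRingEquiv
  have : IsDomain (F ⊗[A] B) := e.injective.isDomain e.toRingHom
  have hfield : IsField (B ⊗[A] F) := by
    refine MulEquiv.isField ?_ e.symm.toMulEquiv
    have : Algebra.IsIntegral F (F ⊗[A] B) := ⟨hfin.to_isIntegral⟩
    exact isField_of_isIntegral_of_isField' (R := F) (S := F ⊗[A] B) (Field.toIsField F)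
  let : Field (B ⊗[A] F) := hfield.toField
  have hBT : Function.Injective (algebraMap B (B ⊗[A] F)) := by
    refine Function.Injective.of_comp (f := ψ) ?_
    have : (ψ ∘ algebraMap B (B ⊗[A] F)) = algebraMap B L := by
      funext b
      change ψ (b ⊗ₜ (1 : F)) = algebraMap B L b
      rw [Algebra.TensorProduct.lift_tmul, map_one, mul_one]
      rfl
    rw [this]
    exact IsFractionRing.injective B L
  have : FaithfulSMul B (B ⊗[A] F) := (faithfulSMul_iff_algebraMap_injective B (B ⊗[A] F)).mpr hBT
  have : IsFractionRing B (B ⊗[A] F) := by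
    refine IsFractionRing.of_field B (B ⊗[A] F) fun z => ?_
    obtain ⟨a, ha, b, hb⟩ := hden z
    refine ⟨b, algebraMap A B a, ?_⟩
    have h0 : algebraMap B (B ⊗[A] F) (algebraMap A B a) ≠ 0 := by
      rwa [Ne, map_eq_zero_iff _ hBT, map_eq_zero_iff _ hinj]
    rw [eq_div_iff h0, mul_comm, ← Algebra.smul_def, algebraMap_smul, hb]
    rfl
  rw [isIntegrallyClosed_iff (B ⊗[A] F)]
  intro x hx
  obtain ⟨w, hw⟩ := (TensorProduct.toIntegralClosure_bijective_of_smooth (R := A) (S := B)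
    (B := F)).2 ⟨x, hx⟩
  have hw' : Algebra.TensorProduct.map (.id B B) (integralClosure A F).val w = x :=
    congrArg Subtype.val hw
  rw [← hw']
  clear hw hw'
  induction w with
  | zero => exact ⟨0, by simp⟩
  | add p q hp hq =>
    obtain ⟨b, hb⟩ := hp
    obtain ⟨c, hc⟩ := hq
    exact ⟨b + c, by rw [map_add, map_add, hb, hc]⟩
  | tmul b f =>
    obtain ⟨a, ha⟩ := (isIntegrallyClosed_iff F).mp ‹IsIntegrallyClosed A› f.2
    refine ⟨a • b, ?_⟩
    rw [Algebra.TensorProduct.map_tmul]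
    change (a • b) ⊗ₜ[A] (1 : F) = b ⊗ₜ[A] (f : F)
    rw [← ha, TensorProduct.smul_tmul, Algebra.algebraMap_eq_smul_one]

/-- The algebraic Hartogs property of a Noetherian normal domain, localized at a prime `p`: a
fraction that is regular at the primes of height one inside `p` is regular at `p`. -/
theorem exists_notMem_smul_mem_of_height_one {B K : Type*} [CommRing B] [IsDomain B]
    [IsNoetherianRing B] [IsIntegrallyClosed B] [Field K] [Algebra B K] [IsFractionRing B K]
    (p : Ideal B) [p.IsPrime] (f : K)
    (h : ∀ q : Ideal B, q.IsPrime → q ≤ p → q.height = 1 →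
      ∃ s, s ∉ q ∧ ∃ b, algebraMap B K s * f = algebraMap B K b) :
    ∃ s, s ∉ p ∧ ∃ b, algebraMap B K s * f = algebraMap B K b := by
  by_contra hcon
  push Not at hcon
  let N : Submodule B K := LinearMap.range (Algebra.linearMap B K)
  have hN : ∀ (s : B) (g : K), s ∈ N.colon {g} ↔
      ∃ b, algebraMap B K s * g = algebraMap B K b := by
    intro s g
    rw [Submodule.mem_colon_singleton, Algebra.smul_def]
    simp only [N, LinearMap.mem_range, Algebra.linearMap_apply, eq_comm]
  have hle : N.colon {f} ≤ p := by
    intro s hs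
    by_contra hsp
    obtain ⟨b, hb⟩ := (hN s f).mp hs
    exact hcon s hsp b hb
  obtain ⟨q, hq, hqp⟩ := Ideal.exists_minimalPrimes_le hle
  have hqprime : q.IsPrime := hq.1.1
  obtain ⟨g, hg⟩ := Submodule.exists_eq_colon_of_mem_minimalPrimes hq
  have hmem : ∀ s, s ∈ q ↔ ∃ b, algebraMap B K s * g = algebraMap B K b := by
    intro s
    rw [hg]
    exact hN s g
  have hinj := IsFractionRing.injective B K
  -- A fraction has a nonzero denominator, so `q` is not zero.
  have hq0 : q ≠ ⊥ := by
    obtain ⟨a, b, hb, rfl⟩ := IsFractionRing.div_surjective (A := B) g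
    have hb0 := nonZeroDivisors.ne_zero hb
    intro h0
    have : b ∈ q := (hmem b).mpr ⟨a, by
      rw [mul_div_cancel₀]; simpa using hb0⟩
    rw [h0] at this
    exact hb0 this
  -- If `g` mapped `q` to itself, it would be integral, hence in `B`.
  have hex : ∃ s ∈ q, ∃ u, u ∉ q ∧ algebraMap B K s * g = algebraMap B K u := by
    by_contra hno
    push Not at hno
    have hint : IsIntegral B g := by
      refine isIntegral_of_smul_mem_submodule (M := K)
        (Submodule.map (Algebra.linearMap B K) q) ?_ ((IsNoetherian.noetherian q).map _) g ?_
      · rw [Ne, (Submodule.map_injective_of_injective (f := Algebra.linearMap B K) hinj).eq_iff'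
          (Submodule.map_bot _)]
        exact hq0
      · rintro _ ⟨s, hs, rfl⟩
        obtain ⟨u, hu⟩ := (hmem s).mp hs
        refine ⟨u, ?_, ?_⟩
        · by_contra huq
          exact hno s hs u huq hu
        · rw [Algebra.linearMap_apply, ← hu, smul_eq_mul, mul_comm]
          rfl
    obtain ⟨y, hy⟩ := (isIntegrallyClosed_iff K).mp ‹_› hint
    exact hqprime.ne_top ((Ideal.eq_top_iff_one q).mpr ((hmem 1).mpr ⟨y, by simp [hy]⟩))
  obtain ⟨s, hs, u, hu, hsu⟩ := hex
  have hs0 : s ≠ 0 := by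
    rintro rfl
    rw [map_zero, zero_mul, eq_comm, map_eq_zero_iff _ hinj] at hsu
    exact hu (hsu ▸ q.zero_mem)
  -- Locally at `q`, the ideal `q` is generated by `s`, so Krull's theorem bounds its height.
  have hmin : q ∈ (Ideal.span {s}).minimalPrimes := by
    refine ⟨⟨hqprime, by simpa [Ideal.span_le] using hs⟩, ?_⟩
    rintro q' ⟨hq', hsq'⟩ hq'q t ht
    obtain ⟨v, hv⟩ := (hmem t).mp ht
    have : t * u = s * v := by
      apply hinj
      rw [map_mul, map_mul, ← hsu, ← hv]
      ring
    have h2 : t * u ∈ q' := by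
      rw [this]
      exact q'.mul_mem_right _ (hsq' (Ideal.mem_span_singleton_self s))
    exact (hq'.mem_or_mem h2).resolve_right fun h3 => hu (hq'q h3)
  have hht : q.height = 1 := by
    refine le_antisymm (Ideal.height_le_one_of_isPrincipal_of_mem_minimalPrimes _ q hmin) ?_
    rw [Order.one_le_iff_ne_zero]
    intro h0
    rw [Ideal.height_eq_zero_iff_eq_bot] at h0
    exact hq0 h0
  obtain ⟨c, hc, b, hb⟩ := h q hqprime hqp hht
  -- `c` is a denominator of `f` outside `q`, although `q` contains all denominators of `f`.
  exact hc (hq.1.2 ((hN c f).mpr ⟨b, hb⟩))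

/-! ### Coordinates at a rational point -/

section Coordinates

open KaehlerDifferential

variable {k R : Type u} [Field k] [CommRing R] [Algebra k R] {r : ℕ}

/-- If the differentials of `x₁, …, x_r` are a basis, the polynomial ring maps to `R` by a formally
smooth (in fact formally étale) homomorphism. This lifting property takes the place of the
completion of `R`. -/
theorem formallySmooth_mvPolynomial [Algebra.FormallySmooth k R] {x : Fin r → R}
    (b : Module.Basis (Fin r) R Ω[R⁄k]) (hb : ∀ i, b i = D k R (x i))
    [Algebra (MvPolynomial (Fin r) k) R] [IsScalarTower k (MvPolynomial (Fin r) k) R]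
    (hX : ∀ i, algebraMap (MvPolynomial (Fin r) k) R (.X i) = x i) :
    Algebra.FormallySmooth (MvPolynomial (Fin r) k) R := by
  let A := MvPolynomial (Fin r) k
  let bA : Module.Basis (Fin r) R (TensorProduct A R Ω[A⁄k]) :=
    (KaehlerDifferential.mvPolynomialBasis k (Fin r)).baseChange R
  have hbA : ∀ i, KaehlerDifferential.mapBaseChange k A R (bA i) = b i := by
    intro i
    simp [bA, A, hb, hX]
  have hbij : Function.Bijective (KaehlerDifferential.mapBaseChange k A R) := by
    have : KaehlerDifferential.mapBaseChange k A R = (bA.equiv b (Equiv.refl _)).toLinearMap :=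
      bA.ext fun i => by simp [hbA]
    rw [this]
    exact (bA.equiv b (Equiv.refl _)).bijective
  have h1 : Subsingleton Ω[R⁄A] := by
    refine subsingleton_of_forall_eq 0 fun y => ?_
    obtain ⟨z, rfl⟩ := KaehlerDifferential.map_surjective k A R y
    obtain ⟨w, rfl⟩ := hbij.2 z
    exact (KaehlerDifferential.exact_mapBaseChange_map k A R).apply_apply_eq_zero w
  have h2 : Subsingleton (Algebra.H1Cotangent A R) := by
    refine subsingleton_of_forall_eq 0 fun y => ?_
    have hy : Algebra.H1Cotangent.δ k A R y = 0 := by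
      apply hbij.1
      rw [map_zero]
      exact (Algebra.H1Cotangent.exact_δ_mapBaseChange k A R).apply_apply_eq_zero y
    obtain ⟨z, rfl⟩ := (Algebra.H1Cotangent.exact_map_δ k A R y).mp hy
    rw [Subsingleton.elim z 0, map_zero]
  exact ⟨inferInstance, h2⟩

variable [IsLocalRing R]

theorem exists_sub_algebraMap_mem_maximalIdeal
    (hres : Function.Surjective ((IsLocalRing.residue R).comp (algebraMap k R))) (b : R) :
    ∃ c : k, b - algebraMap k R c ∈ IsLocalRing.maximalIdeal R := by
  obtain ⟨c, hc⟩ := hres (IsLocalRing.residue R b)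
  refine ⟨c, ?_⟩
  rw [← IsLocalRing.residue_eq_zero_iff, map_sub, sub_eq_zero]
  exact hc.symm

/-- Nakayama: generators of the maximal ideal at a rational point are coordinates, provided that
there are as many as the rank of the free module of differentials. -/
theorem exists_basis_eq_D (e : Module.Basis (Fin r) R Ω[R⁄k])
    (hres : Function.Surjective ((IsLocalRing.residue R).comp (algebraMap k R)))
    {x : Fin r → R} (hx : Ideal.span (Set.range x) = IsLocalRing.maximalIdeal R) :
    ∃ b : Module.Basis (Fin r) R Ω[R⁄k], ∀ i, b i = D k R (x i) := by
  let N : Submodule R Ω[R⁄k] := Submodule.span R (Set.range fun i => D k R (x i))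
  have hN : N = ⊤ := by
    have : Module.Finite R Ω[R⁄k] := .of_basis e
    refine top_le_iff.mp (Submodule.le_of_le_smul_of_le_jacobson_bot Module.Finite.fg_top
      (IsLocalRing.maximalIdeal_le_jacobson ⊥) ?_)
    rw [← KaehlerDifferential.span_range_derivation k R, Submodule.span_le]
    rintro _ ⟨b, rfl⟩
    obtain ⟨c, hc⟩ := exists_sub_algebraMap_mem_maximalIdeal hres b
    have hD : D k R b = D k R (b - algebraMap k R c) := by simp
    rw [SetLike.mem_coe, hD]
    generalize b - algebraMap k R c = m at hc
    rw [← hx] at hc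
    obtain ⟨a, rfl⟩ := (Ideal.mem_span_range_iff_exists_fun).mp hc
    rw [map_sum]
    refine Submodule.sum_mem _ fun i _ => ?_
    rw [Derivation.leibniz, add_comm]
    refine Submodule.add_mem _ ?_ ?_
    · exact Submodule.mem_sup_right (Submodule.smul_mem_smul
        (hx ▸ Ideal.subset_span (Set.mem_range_self i)) (Submodule.subset_span ⟨_, rfl⟩))
    · exact Submodule.mem_sup_left (Submodule.smul_mem _ _ (Submodule.subset_span ⟨i, rfl⟩))
  let φ : Ω[R⁄k] →ₗ[R] Ω[R⁄k] := e.constr R fun i => D k R (x i)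
  have hφ : Function.Surjective φ := by
    rw [← LinearMap.range_eq_top, Module.Basis.constr_range]
    exact hN
  have : Module.Finite R Ω[R⁄k] := .of_basis e
  have hφ' : Function.Bijective φ :=
    ⟨OrzechProperty.injective_of_surjective_endomorphism φ hφ, hφ⟩
  exact ⟨e.map (LinearEquiv.ofBijective φ hφ'), fun i => by simp [φ]⟩

/-- A polynomial whose value at the coordinates lies in the `N`-th power of the maximal ideal
has no terms of degree less than `N`: formal smoothness lifts `R → k` to a map from `R` to the
truncated polynomial ring, which sends the coordinates to the variables. -/
theorem mem_idealOfVars_pow_of_aeval_mem [Algebra.FormallySmooth k R]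
    (e : Module.Basis (Fin r) R Ω[R⁄k])
    (hres : Function.Bijective ((IsLocalRing.residue R).comp (algebraMap k R)))
    {x : Fin r → R} (hx : Ideal.span (Set.range x) = IsLocalRing.maximalIdeal R)
    {p : MvPolynomial (Fin r) k} {N : ℕ}
    (hp : MvPolynomial.aeval x p ∈ IsLocalRing.maximalIdeal R ^ N) :
    p ∈ MvPolynomial.idealOfVars (Fin r) k ^ N := by
  obtain ⟨b, hb⟩ := exists_basis_eq_D e hres.2 hx
  let : Algebra (MvPolynomial (Fin r) k) R := (MvPolynomial.aeval (R := k) x).toRingHom.toAlgebra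
  have halg : ∀ q, algebraMap (MvPolynomial (Fin r) k) R q = MvPolynomial.aeval x q :=
    fun q => rfl
  have : IsScalarTower k (MvPolynomial (Fin r) k) R :=
    IsScalarTower.of_algebraMap_eq fun c => by rw [halg]; simp
  have : Algebra.FormallySmooth (MvPolynomial (Fin r) k) R :=
    formallySmooth_mvPolynomial b hb fun i => by rw [halg]; simp
  let C := MvPolynomial (Fin r) k ⧸ MvPolynomial.idealOfVars (Fin r) k ^ N
  let I : Ideal C := (MvPolynomial.idealOfVars (Fin r) k).map (Ideal.Quotient.mk _)
  have hI : IsNilpotent I := ⟨N, by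
    rw [← Ideal.map_pow, Ideal.map_quotient_self, Ideal.zero_eq_bot]⟩
  -- The residue map, regarded as a map to `C ⧸ I` over the polynomial ring.
  let ρ : k ≃+* IsLocalRing.ResidueField R := RingEquiv.ofBijective _ hres
  let g₀ : R →+* C ⧸ I := (algebraMap k (C ⧸ I)).comp
    (ρ.symm.toRingHom.comp (IsLocalRing.residue R))
  have hg₀k : ∀ c : k, g₀ (algebraMap k R c) = algebraMap k (C ⧸ I) c := by
    intro c
    have : ρ.symm (IsLocalRing.residue R (algebraMap k R c)) = c := by
      rw [RingEquiv.symm_apply_eq]; rfl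
    simp only [g₀, RingHom.comp_apply, RingEquiv.toRingHom_eq_coe, RingHom.coe_coe, this]
  have hg₀x : ∀ m ∈ IsLocalRing.maximalIdeal R, g₀ m = 0 := by
    intro m hm
    simp only [g₀, RingHom.comp_apply, (IsLocalRing.residue_eq_zero_iff m).mpr hm, map_zero]
  have hg₀ : g₀.comp (algebraMap (MvPolynomial (Fin r) k) R) =
      algebraMap (MvPolynomial (Fin r) k) (C ⧸ I) := by
    refine MvPolynomial.ringHom_ext (fun c => ?_) fun i => ?_
    · rw [RingHom.comp_apply, halg, MvPolynomial.aeval_C, hg₀k]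
      rfl
    · rw [RingHom.comp_apply, halg, MvPolynomial.aeval_X,
        hg₀x _ (hx ▸ Ideal.subset_span (Set.mem_range_self i))]
      symm
      change Ideal.Quotient.mk I (Ideal.Quotient.mk _ (MvPolynomial.X i)) = 0
      rw [Ideal.Quotient.eq_zero_iff_mem]
      exact Ideal.mem_map_of_mem _ (Ideal.subset_span (Set.mem_range_self i))
  let g : R →ₐ[MvPolynomial (Fin r) k] C ⧸ I :=
    { g₀ with commutes' := fun q => RingHom.congr_fun hg₀ q }
  obtain ⟨f, hf⟩ := Algebra.FormallySmooth.exists_lift I hI g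
  have hfm : (IsLocalRing.maximalIdeal R).map f.toRingHom ≤ I := by
    rw [Ideal.map_le_iff_le_comap]
    intro m hm
    have : Ideal.Quotient.mk I (f m) = g m := AlgHom.congr_fun hf m
    rw [Ideal.mem_comap]
    change f m ∈ I
    rw [← Ideal.Quotient.eq_zero_iff_mem, this]
    exact hg₀x m hm
  have h1 : f (MvPolynomial.aeval x p) ∈ I ^ N :=
    Ideal.pow_right_mono hfm N (Ideal.map_pow (f := f.toRingHom) _ N ▸ Ideal.mem_map_of_mem _ hp)
  rw [← halg, f.commutes, ← Ideal.map_pow, Ideal.map_quotient_self] at h1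
  exact Ideal.Quotient.eq_zero_iff_mem.mp h1

theorem exists_aeval_sub_mem_pow
    (hres : Function.Surjective ((IsLocalRing.residue R).comp (algebraMap k R)))
    {x : Fin r → R} (hx : Ideal.span (Set.range x) = IsLocalRing.maximalIdeal R) (h : R) (N : ℕ) :
    ∃ p : MvPolynomial (Fin r) k,
      h - MvPolynomial.aeval x p ∈ IsLocalRing.maximalIdeal R ^ N := by
  induction N with
  | zero => exact ⟨0, by simp⟩
  | succ N ih =>
    obtain ⟨p, hp⟩ := ih
    have key : ∀ y ∈ IsLocalRing.maximalIdeal R ^ N, ∃ q : MvPolynomial (Fin r) k,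
        y - MvPolynomial.aeval x q ∈ IsLocalRing.maximalIdeal R ^ (N + 1) := by
      have hmap : IsLocalRing.maximalIdeal R ^ N =
          Ideal.span ((MvPolynomial.aeval (R := k) x) ''
            (MvPolynomial.idealOfVars (Fin r) k ^ N : Ideal _)) := by
        rw [← hx]
        change _ = Ideal.map (MvPolynomial.aeval (R := k) x) _
        rw [Ideal.map_pow, MvPolynomial.idealOfVars, Ideal.map_span, ← Set.range_comp]
        congr 3
        ext i
        simp
      intro y hy
      rw [hmap] at hy
      induction hy using Submodule.span_induction with
      | mem y hy =>
        obtain ⟨q, -, rfl⟩ := hy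
        exact ⟨q, by simp⟩
      | zero => exact ⟨0, by simp⟩
      | add y z _ _ hy hz =>
        obtain ⟨q, hq⟩ := hy
        obtain ⟨q', hq'⟩ := hz
        refine ⟨q + q', ?_⟩
        rw [map_add, add_sub_add_comm]
        exact Ideal.add_mem _ hq hq'
      | smul b y hy ih =>
        obtain ⟨q, hq⟩ := ih
        obtain ⟨c, hc⟩ := exists_sub_algebraMap_mem_maximalIdeal hres b
        refine ⟨MvPolynomial.C c * q, ?_⟩
        have : b • y - MvPolynomial.aeval x (MvPolynomial.C c * q) =
            algebraMap k R c * (y - MvPolynomial.aeval x q) + (b - algebraMap k R c) * y := by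
          rw [map_mul, MvPolynomial.aeval_C, smul_eq_mul]
          ring
        rw [this]
        refine Ideal.add_mem _ (Ideal.mul_mem_left _ _ hq) ?_
        rw [pow_succ']
        exact Ideal.mul_mem_mul hc (hmap ▸ hy)
    obtain ⟨q, hq⟩ := key _ hp
    exact ⟨p + q, by rwa [map_add, ← sub_sub]⟩

/-- Every element has a power series expansion in the coordinates. -/
theorem exists_expansion [Algebra.FormallySmooth k R]
    (e : Module.Basis (Fin r) R Ω[R⁄k])
    (hres : Function.Bijective ((IsLocalRing.residue R).comp (algebraMap k R)))
    {x : Fin r → R} (hx : Ideal.span (Set.range x) = IsLocalRing.maximalIdeal R) (h : R) :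
    ∃ c : (Fin r → ℕ) → k, ∀ N : ℕ,
      h - ∑ I ∈ Fintype.piFinset (fun _ : Fin r => Finset.range N),
        algebraMap k R (c I) * ∏ j, x j ^ I j ∈ IsLocalRing.maximalIdeal R ^ N := by
  choose p hp using exists_aeval_sub_mem_pow hres.2 hx h
  -- Truncations of the approximating polynomials agree, so their coefficients stabilize.
  have hcoeff : ∀ (M N : ℕ), M ≤ N → ∀ I : Fin r →₀ ℕ, I.degree < M →
      (p N).coeff I = (p M).coeff I := by
    intro M N hMN I hI
    have h1 : MvPolynomial.aeval x (p N - p M) ∈ IsLocalRing.maximalIdeal R ^ M := by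
      have := Ideal.sub_mem _ (hp M) (Ideal.pow_le_pow_right hMN (hp N))
      rwa [sub_sub_sub_cancel_left, ← map_sub] at this
    have h2 := (MvPolynomial.mem_pow_idealOfVars_iff' _ _).mp
      (mem_idealOfVars_pow_of_aeval_mem e hres hx h1) I hI
    rwa [MvPolynomial.coeff_sub, sub_eq_zero] at h2
  let c : (Fin r → ℕ) → k := fun I =>
    (p ((Finsupp.equivFunOnFinite.symm I).degree + 1)).coeff (Finsupp.equivFunOnFinite.symm I)
  refine ⟨c, fun N => ?_⟩
  let q : MvPolynomial (Fin r) k := ∑ I ∈ Fintype.piFinset (fun _ : Fin r => Finset.range N),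
    MvPolynomial.monomial (Finsupp.equivFunOnFinite.symm I) (c I)
  have hq : MvPolynomial.aeval x q = ∑ I ∈ Fintype.piFinset (fun _ : Fin r => Finset.range N),
        algebraMap k R (c I) * ∏ j, x j ^ I j := by
    rw [map_sum]
    refine Finset.sum_congr rfl fun I _ => ?_
    rw [MvPolynomial.aeval_monomial, Finsupp.prod_fintype _ _ fun _ => pow_zero _]
    simp
  have hpq : p N - q ∈ MvPolynomial.idealOfVars (Fin r) k ^ N := by
    refine (MvPolynomial.mem_pow_idealOfVars_iff' _ _).mpr fun I hI => ?_
    have hIN : ∀ i, I i < N := fun i => (Finsupp.le_degree i I).trans_lt hI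
    have : q.coeff I = c I := by
      rw [MvPolynomial.coeff_sum, Finset.sum_eq_single (I : Fin r → ℕ)]
      · simp [MvPolynomial.coeff_monomial]
      · intro J _ hJ
        rw [MvPolynomial.coeff_monomial, if_neg]
        rintro rfl
        exact hJ (by simp)
      · intro hI'
        exact absurd (Fintype.mem_piFinset.mpr fun i => Finset.mem_range.mpr (hIN i)) hI'
    rw [MvPolynomial.coeff_sub, this, sub_eq_zero, hcoeff (I.degree + 1) N hI I (Nat.lt_succ_self _)]
    simp [c]
  rw [← hq]
  have h3 : MvPolynomial.aeval x (p N - q) ∈ IsLocalRing.maximalIdeal R ^ N := by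
    rw [← hx]
    have := Ideal.mem_map_of_mem (MvPolynomial.aeval (R := k) x) hpq
    rw [Ideal.map_pow, MvPolynomial.idealOfVars, Ideal.map_span, ← Set.range_comp] at this
    convert this using 4
    ext i
    simp
  have := Ideal.add_mem _ (hp N) h3
  rwa [map_sub, sub_add_sub_cancel] at this

/-- The coefficient of the socle monomial in the expansion of an element that is congruent to a
multiple of this monomial modulo `(x₁ ^ a, …, x_r ^ a)`. -/
theorem coeff_expansion_eq [Algebra.FormallySmooth k R]
    (e : Module.Basis (Fin r) R Ω[R⁄k])
    (hres : Function.Bijective ((IsLocalRing.residue R).comp (algebraMap k R)))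
    {x : Fin r → R} (hx : Ideal.span (Set.range x) = IsLocalRing.maximalIdeal R) {h : R}
    {d : (Fin r → ℕ) → k} (hd : ∀ N : ℕ,
      h - ∑ I ∈ Fintype.piFinset (fun _ : Fin r => Finset.range N),
        algebraMap k R (d I) * ∏ j, x j ^ I j ∈ IsLocalRing.maximalIdeal R ^ N)
    {a : ℕ} (ha : 0 < a) {c : k}
    (hc : h - algebraMap k R c * ∏ i, x i ^ (a - 1) ∈
      Ideal.span (Set.range fun i => x i ^ a)) :
    d (fun _ => a - 1) = c := by
  let s : Fin r →₀ ℕ := Finsupp.equivFunOnFinite.symm fun _ => a - 1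
  let N := s.degree + 1
  have hsN : ∀ i, s i < N := fun i => Nat.lt_succ_of_le (Finsupp.le_degree i s)
  obtain ⟨g, hg⟩ := Ideal.mem_span_range_iff_exists_fun.mp hc
  choose p hp using fun i => exists_aeval_sub_mem_pow hres.2 hx (g i) N
  let q : MvPolynomial (Fin r) k := ∑ I ∈ Fintype.piFinset (fun _ : Fin r => Finset.range N),
    MvPolynomial.monomial (Finsupp.equivFunOnFinite.symm I) (d I)
  have hq : MvPolynomial.aeval x q = ∑ I ∈ Fintype.piFinset (fun _ : Fin r => Finset.range N),
        algebraMap k R (d I) * ∏ j, x j ^ I j := by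
    rw [map_sum]
    refine Finset.sum_congr rfl fun I _ => ?_
    rw [MvPolynomial.aeval_monomial, Finsupp.prod_fintype _ _ fun _ => pow_zero _]
    simp
  let w : MvPolynomial (Fin r) k := MvPolynomial.monomial s c + ∑ i, p i * MvPolynomial.X i ^ a - q
  have hw : MvPolynomial.aeval x w ∈ IsLocalRing.maximalIdeal R ^ N := by
    have h1 : MvPolynomial.aeval x w =
        (h - ∑ I ∈ Fintype.piFinset (fun _ : Fin r => Finset.range N),
          algebraMap k R (d I) * ∏ j, x j ^ I j) -
        ∑ i, (g i - MvPolynomial.aeval x (p i)) * x i ^ a := by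
      have h2 : h = algebraMap k R c * ∏ i, x i ^ (a - 1) + ∑ i, g i * x i ^ a := by
        rw [hg]; ring
      have h3 : MvPolynomial.aeval x (MvPolynomial.monomial s c) =
          algebraMap k R c * ∏ i, x i ^ (a - 1) := by
        rw [MvPolynomial.aeval_monomial, Finsupp.prod_fintype _ _ fun _ => pow_zero _]
        simp [s]
      simp only [w, map_sub, map_add, hq, h3, map_sum, map_mul, map_pow, MvPolynomial.aeval_X,
        sub_mul, Finset.sum_sub_distrib]
      linear_combination -h2
    rw [h1]
    exact Ideal.sub_mem _ (hd N) (Ideal.sum_mem _ fun i _ => Ideal.mul_mem_right _ _ (hp i))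
  have h0 := (MvPolynomial.mem_pow_idealOfVars_iff' _ _).mp
    (mem_idealOfVars_pow_of_aeval_mem e hres hx hw) s (Nat.lt_succ_self _)
  have hqs : q.coeff s = d fun _ => a - 1 := by
    rw [MvPolynomial.coeff_sum, Finset.sum_eq_single fun _ => a - 1]
    · simp [s, MvPolynomial.coeff_monomial]
    · intro J _ hJ
      rw [MvPolynomial.coeff_monomial, if_neg]
      intro hJs
      exact hJ (Finsupp.equivFunOnFinite.symm.injective hJs)
    · intro hI'
      exact absurd (Fintype.mem_piFinset.mpr fun i => Finset.mem_range.mpr (hsN i)) hI'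
  have hps : ∀ i, (p i * MvPolynomial.X i ^ a).coeff s = 0 := by
    intro i
    rw [MvPolynomial.X_pow_eq_monomial, MvPolynomial.coeff_mul_monomial', if_neg]
    intro hle
    have := hle i
    simp [s] at this
    omega
  simp only [w, MvPolynomial.coeff_sub, MvPolynomial.coeff_add, MvPolynomial.coeff_sum, hps,
    Finset.sum_const_zero, add_zero, hqs, MvPolynomial.coeff_monomial, if_true] at h0
  exact (sub_eq_zero.mp h0).symm

end Coordinates

/-! ### Top forms over a ring with a coordinate system -/

section TopForms

open KaehlerDifferential

variable {k R K : Type u} [Field k] [CommRing R] [Algebra k R] [Field K] [Algebra k K]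
  [Algebra R K] [IsScalarTower k R K] [IsFractionRing R K] {r : ℕ}

variable (K) in
/-- The differentials of coordinates are also a basis over the fraction field. -/
theorem exists_fractionField_basis_eq_D {x : Fin r → R} (b : Module.Basis (Fin r) R Ω[R⁄k])
    (hb : ∀ i, b i = D k R (x i)) :
    ∃ E : Module.Basis (Fin r) K Ω[K⁄k], ∀ i, E i = D k K (algebraMap R K (x i)) :=
  ⟨b.ofIsLocalizedModule K (nonZeroDivisors R) (KaehlerDifferential.map k k R K), fun i => by
    simp [hb]⟩

theorem exists_localization_basis_eq_D {S : Type u} [CommRing S] [Algebra k S] [Algebra R S]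
    [IsScalarTower k R S] (M : Submonoid R) [IsLocalization M S]
    {x : Fin r → R} (b : Module.Basis (Fin r) R Ω[R⁄k]) (hb : ∀ i, b i = D k R (x i)) :
    ∃ E : Module.Basis (Fin r) S Ω[S⁄k], ∀ i, E i = D k S (algebraMap R S (x i)) :=
  ⟨b.ofIsLocalizedModule S M (KaehlerDifferential.map k k R S), fun i => by simp [hb]⟩

theorem ιMulti_eq_det_smul (E : Module.Basis (Fin r) K Ω[K⁄k]) (v : Fin r → Ω[K⁄k]) :
    exteriorPower.ιMulti K r v = E.det v • exteriorPower.ιMulti K r E := by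
  let g : Ω[K⁄k] [⋀^Fin r]→ₗ[K] ⋀[K]^r Ω[K⁄k] :=
    (LinearMap.toSpanSingleton K _ (exteriorPower.ιMulti K r E)).compAlternatingMap E.det
  have : exteriorPower.ιMulti K r = g := by
    refine Module.Basis.ext_alternating E fun σ hσ => ?_
    let τ : Equiv.Perm (Fin r) := Equiv.ofBijective σ (Finite.injective_iff_bijective.mp hσ)
    have h1 := (exteriorPower.ιMulti K r (M := Ω[K⁄k])).map_perm E τ
    have h2 := E.det.map_perm E τ
    change exteriorPower.ιMulti K r (E ∘ τ) = E.det (E ∘ τ) • _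
    rw [h1, h2, Module.Basis.det_self]
    rcases Int.units_eq_one_or (Equiv.Perm.sign τ) with h | h
    · rw [h, one_smul, one_smul, one_smul]
    · rw [h, Units.neg_smul, one_smul, Units.neg_smul, one_smul]
      exact (neg_one_smul K _).symm
  exact AlternatingMap.congr_fun this v

theorem exists_eq_smul_ιMulti (E : Module.Basis (Fin r) K Ω[K⁄k]) (ω : ⋀[K]^r Ω[K⁄k]) :
    ∃ h : K, ω = h • exteriorPower.ιMulti K r E := by
  have hω : ω ∈ Submodule.span K (Set.range (exteriorPower.ιMulti K r (M := Ω[K⁄k]))) := by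
    rw [exteriorPower.ιMulti_span]; trivial
  induction hω using Submodule.span_induction with
  | mem y hy =>
    obtain ⟨v, rfl⟩ := hy
    exact ⟨E.det v, ιMulti_eq_det_smul E v⟩
  | zero => exact ⟨0, by simp⟩
  | add y z _ _ hy hz =>
    obtain ⟨a, rfl⟩ := hy
    obtain ⟨c, rfl⟩ := hz
    exact ⟨a + c, by rw [add_smul]⟩
  | smul c y _ hy =>
    obtain ⟨a, rfl⟩ := hy
    exact ⟨c * a, by rw [mul_smul]⟩

theorem ιMulti_basis_ne_zero (E : Module.Basis (Fin r) K Ω[K⁄k]) :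
    exteriorPower.ιMulti K r E ≠ 0 := by
  intro h
  have := exteriorPower.alternatingMapLinearEquiv_apply_ιMulti E.det E
  rw [h, map_zero, Module.Basis.det_self] at this
  exact zero_ne_one this

/-- The form `dv₁ ∧ ⋯ ∧ dv_r` is the multiple of `dx₁ ∧ ⋯ ∧ dx_r` by a Jacobian determinant, which
lies in `R`. -/
theorem exists_ιMulti_D_eq_smul {x : Fin r → R} (b : Module.Basis (Fin r) R Ω[R⁄k])
    (hb : ∀ i, b i = D k R (x i)) (v : Fin r → R) :
    ∃ d : R, exteriorPower.ιMulti K r (fun i => D k K (algebraMap R K (v i))) =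
      algebraMap R K d • exteriorPower.ιMulti K r (fun i => D k K (algebraMap R K (x i))) := by
  obtain ⟨E, hE⟩ := exists_fractionField_basis_eq_D K b hb
  have hEx : (fun i => D k K (algebraMap R K (x i))) = E := (funext hE).symm
  refine ⟨b.det fun i => D k R (v i), ?_⟩
  rw [ιMulti_eq_det_smul E, hEx]
  congr 1
  rw [Module.Basis.det_apply, Module.Basis.det_apply, RingHom.map_det]
  congr 1
  ext i j
  rw [RingHom.mapMatrix_apply, Matrix.map_apply, Module.Basis.toMatrix_apply,
    Module.Basis.toMatrix_apply]
  have h2 : D k K (algebraMap R K (v j)) =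
      ∑ l, algebraMap R K (b.repr (D k R (v j)) l) • E l := by
    have h3 := congrArg (KaehlerDifferential.map k k R K) (b.sum_repr (D k R (v j)))
    rw [KaehlerDifferential.map_D, map_sum] at h3
    rw [← h3]
    refine Finset.sum_congr rfl fun l _ => ?_
    rw [map_smul, hb, KaehlerDifferential.map_D, hE, algebraMap_smul]
  rw [h2, Module.Basis.repr_sum_self]

end TopForms

/-! ### Generators of the regular forms at a point -/

section Generators

variable {k : Type u} [Field k] {X : Scheme.{u}} [IsIntegral X]
  [X.Over (Spec (CommRingCat.of k))] {r : ℕ}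

/-- The elements `x₁, …, x_r` of the local ring at `P` are coordinates: their differentials are a
basis of the module of Kähler differentials. -/
def IsCoordinates (k : Type u) [Field k] {X : Scheme.{u}} [X.Over (Spec (CommRingCat.of k))]
    {P : X} (x : Fin r → X.presheaf.stalk P) : Prop :=
  ∃ b : Module.Basis (Fin r) (X.presheaf.stalk P) Ω[X.presheaf.stalk P⁄k],
    ∀ i, b i = KaehlerDifferential.D k _ (x i)

/-- The structure maps `k → 𝒪_{X,P} → k(X)` are compatible. -/
theorem isScalarTower_functionField (P : X) :
    IsScalarTower k (X.presheaf.stalk P) X.functionField := by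
  refine IsScalarTower.of_algebraMap_eq fun c => ?_
  change structureMap k X (genericPoint X) c = toFun P (structureMap k X P c)
  simp only [structureMap, CommRingCat.hom_comp, RingHom.comp_apply]
  exact (TopCat.Presheaf.germ_stalkSpecializes_apply X.presheaf _ _ _).symm

variable {P : X} {x : Fin r → X.presheaf.stalk P}

theorem IsCoordinates.dWedge_ne_zero (hx : IsCoordinates k x) :
    dWedge k (fun i => toFun P (x i)) ≠ 0 := by
  have := isScalarTower_functionField (k := k) P
  obtain ⟨b, hb⟩ := hx
  obtain ⟨E, hE⟩ := exists_fractionField_basis_eq_D X.functionField b hb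
  rw [dWedge, ← funext hE]
  exact ιMulti_basis_ne_zero E

theorem IsCoordinates.exists_eq_smul (hx : IsCoordinates k x) (ω : RatForm k X r) :
    ∃ h : X.functionField, ω = h • dWedge k (fun i => toFun P (x i)) := by
  have := isScalarTower_functionField (k := k) P
  obtain ⟨b, hb⟩ := hx
  obtain ⟨E, hE⟩ := exists_fractionField_basis_eq_D X.functionField b hb
  rw [dWedge, ← funext hE]
  exact exists_eq_smul_ιMulti E ω

theorem IsCoordinates.isGenerator (hx : IsCoordinates k x) :
    IsGenerator P (dWedge k (fun i => toFun P (x i))) := by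
  have := isScalarTower_functionField (k := k) P
  obtain ⟨b, hb⟩ := hx
  intro ω
  constructor
  · intro hω
    induction hω using AddSubgroup.closure_induction with
    | mem ω hω =>
      obtain ⟨a, v, rfl⟩ := hω
      obtain ⟨d, hd⟩ := exists_ιMulti_D_eq_smul (K := X.functionField) b hb v
      refine ⟨a * d, ?_⟩
      rw [map_mul, mul_smul]
      congr 1
    | zero => exact ⟨0, by simp⟩
    | add ω ω' _ _ h h' =>
      obtain ⟨a, rfl⟩ := h
      obtain ⟨a', rfl⟩ := h'
      exact ⟨a + a', by rw [map_add, add_smul]⟩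
    | neg ω _ h =>
      obtain ⟨a, rfl⟩ := h
      exact ⟨-a, by rw [map_neg]; exact (neg_smul _ _).symm⟩
  · rintro ⟨a, rfl⟩
    exact AddSubgroup.subset_closure ⟨a, x, rfl⟩

end Generators

/-! ### Standard smooth charts -/

section Charts

variable {k : Type u} [Field k] {X : Scheme.{u}} [X.Over (Spec (CommRingCat.of k))] {r : ℕ}

/-- The structure map `k → Γ(X, W)` of a `k`-scheme. -/
def sectionMap (k : Type u) [Field k] (X : Scheme.{u}) [X.Over (Spec (CommRingCat.of k))]
    (W : X.Opens) : k →+* Γ(X, W) :=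
  ((Scheme.ΓSpecIso (CommRingCat.of k)).inv ≫ (X ↘ Spec (CommRingCat.of k)).appTop ≫
    X.presheaf.map (homOfLE le_top).op).hom

theorem germ_sectionMap (W : X.Opens) (Q : X) (hQ : Q ∈ W) (c : k) :
    X.presheaf.germ W Q hQ (sectionMap k X W c) = algebraMap k (X.presheaf.stalk Q) c := by
  change _ = structureMap k X Q c
  simp only [structureMap, sectionMap, CommRingCat.hom_comp, RingHom.comp_apply]
  exact TopCat.Presheaf.germ_res_apply X.presheaf _ _ hQ _

variable (k r) in
/-- An affine open set whose ring is standard smooth of relative dimension `r` over `k`. -/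
structure IsChart (W : X.Opens) : Prop where
  isAffineOpen : IsAffineOpen W
  isStandardSmooth : (sectionMap k X W).IsStandardSmoothOfRelativeDimension r

theorem exists_isChart [SmoothOfRelativeDimension r (X ↘ Spec (CommRingCat.of k))] (P : X) :
    ∃ W : X.Opens, P ∈ W ∧ IsChart k r W := by
  obtain ⟨U, hU, V, hV, hPV, e, h⟩ :=
    SmoothOfRelativeDimension.exists_isStandardSmoothOfRelativeDimension (n := r)
      (f := X ↘ Spec (CommRingCat.of k)) P
  have : Subsingleton (Spec (CommRingCat.of k)) :=
    inferInstanceAs (Subsingleton (PrimeSpectrum k))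
  obtain rfl : U = ⊤ := by
    refine top_le_iff.mp fun y _ => ?_
    rw [Subsingleton.elim y]
    exact e hPV
  refine ⟨V, hPV, hV, ?_⟩
  have h2 := (RingHom.isStandardSmoothOfRelativeDimension_respectsIso (n := r)).2 _
    (Scheme.ΓSpecIso (CommRingCat.of k)).symm.commRingCatIsoToRingEquiv h
  exact h2

variable {W : X.Opens}

/-- The ring of a chart contains functions that are coordinates at every point of the chart. -/
theorem IsChart.exists_isCoordinates (hW : IsChart k r W) [Nonempty W] :
    ∃ t : Fin r → Γ(X, W), ∀ (Q : X) (hQ : Q ∈ W),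
      IsCoordinates k fun i => X.presheaf.germ W Q hQ (t i) := by
  let : Algebra k Γ(X, W) := (sectionMap k X W).toAlgebra
  have hstd : Algebra.IsStandardSmoothOfRelativeDimension r k Γ(X, W) := hW.isStandardSmooth
  have : Algebra.IsStandardSmooth k Γ(X, W) := hstd.isStandardSmooth
  obtain ⟨-, I, b, hb⟩ := Algebra.IsStandardSmooth.iff_exists_basis_kaehlerDifferential.mp this
  have hrank : Module.rank Γ(X, W) Ω[Γ(X, W)⁄k] = r :=
    Algebra.IsStandardSmoothOfRelativeDimension.rank_kaehlerDifferential r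
  have hI : Cardinal.mk I = r := by
    have := b.mk_eq_rank
    rw [hrank] at this
    simpa using this
  obtain ⟨σ⟩ : Nonempty (I ≃ Fin r) := by
    rw [← Cardinal.eq, hI, Cardinal.mk_fin]
  let b' := b.reindex σ
  have hb' : ∀ i, ∃ t, KaehlerDifferential.D k Γ(X, W) t = b' i := by
    intro i
    rw [Module.Basis.reindex_apply]
    exact hb ⟨_, rfl⟩
  choose t ht using hb'
  refine ⟨t, fun Q hQ => ?_⟩
  let : Algebra Γ(X, W) (X.presheaf.stalk Q) := (X.presheaf.germ W Q hQ).hom.toAlgebra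
  have : IsScalarTower k Γ(X, W) (X.presheaf.stalk Q) :=
    IsScalarTower.of_algebraMap_eq fun c => (germ_sectionMap W Q hQ c).symm
  have : IsLocalization.AtPrime (X.presheaf.stalk Q)
      (hW.isAffineOpen.primeIdealOf ⟨Q, hQ⟩).asIdeal :=
    hW.isAffineOpen.isLocalization_stalk ⟨Q, hQ⟩
  exact exists_localization_basis_eq_D
    (hW.isAffineOpen.primeIdealOf ⟨Q, hQ⟩).asIdeal.primeCompl b' fun i => (ht i).symm

theorem IsChart.formallySmooth_stalk (hW : IsChart k r W) {Q : X} (hQ : Q ∈ W) :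
    Algebra.FormallySmooth k (X.presheaf.stalk Q) := by
  let : Algebra k Γ(X, W) := (sectionMap k X W).toAlgebra
  have hstd : Algebra.IsStandardSmoothOfRelativeDimension r k Γ(X, W) := hW.isStandardSmooth
  have : Algebra.IsStandardSmooth k Γ(X, W) := hstd.isStandardSmooth
  let : Algebra Γ(X, W) (X.presheaf.stalk Q) := (X.presheaf.germ W Q hQ).hom.toAlgebra
  have : IsScalarTower k Γ(X, W) (X.presheaf.stalk Q) :=
    IsScalarTower.of_algebraMap_eq fun c => (germ_sectionMap W Q hQ c).symm
  have : IsLocalization.AtPrime (X.presheaf.stalk Q)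
      (hW.isAffineOpen.primeIdealOf ⟨Q, hQ⟩).asIdeal :=
    hW.isAffineOpen.isLocalization_stalk ⟨Q, hQ⟩
  have : Algebra.FormallySmooth Γ(X, W) (X.presheaf.stalk Q) :=
    Algebra.FormallySmooth.of_isLocalization
      (hW.isAffineOpen.primeIdealOf ⟨Q, hQ⟩).asIdeal.primeCompl
  exact Algebra.FormallySmooth.comp k Γ(X, W) (X.presheaf.stalk Q)

/-- The ring of a chart is étale over a polynomial ring, hence normal. -/
theorem IsChart.isIntegrallyClosed [IsIntegral X] (hW : IsChart k r W) [Nonempty W] :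
    IsIntegrallyClosed Γ(X, W) := by
  obtain ⟨g, -, hg⟩ := hW.isStandardSmooth.exists_etale_mvPolynomial
  let : Algebra (MvPolynomial (Fin r) k) Γ(X, W) := g.toAlgebra
  have : Algebra.Etale (MvPolynomial (Fin r) k) Γ(X, W) := hg
  exact isIntegrallyClosed_of_etale (MvPolynomial (Fin r) k) Γ(X, W)

end Charts

/-! ### Orders of rational functions along prime divisors -/

section Orders

variable {X : Scheme.{u}} [IsIntegral X]

theorem toFun_stalkSpecializes {P Q : X} (h : Q ⤳ P) (g : X.presheaf.stalk P) :
    toFun Q (X.presheaf.stalkSpecializes h g) = toFun P g :=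
  congrArg (fun φ => φ.hom g)
    (X.presheaf.stalkSpecializes_comp (genericPoint_specializes Q) h)

/-- A rational function regular at `P` is regular at the generizations of `P`. -/
theorem IsRegularAt.of_specializes {P Q : X} (h : Q ⤳ P) {f : X.functionField}
    (hf : IsRegularAt P f) : IsRegularAt Q f := by
  obtain ⟨g, rfl⟩ := hf
  exact ⟨X.presheaf.stalkSpecializes h g, toFun_stalkSpecializes h g⟩

theorem toFun_germ {W : X.Opens} {P Q : X} (hP : P ∈ W) (hQ : Q ∈ W) (t : Γ(X, W)) :
    toFun P (X.presheaf.germ W P hP t) = toFun Q (X.presheaf.germ W Q hQ t) := by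
  have : Nonempty W := ⟨⟨P, hP⟩⟩
  have h (Q : X) (hQ : Q ∈ W) : toFun Q (X.presheaf.germ W Q hQ t) = X.germToFunctionField W t :=
    X.algebraMap_germ_eq_germToFunctionField hQ t
  rw [h P hP, h Q hQ]

variable {k : Type u} [Field k] [X.Over (Spec (CommRingCat.of k))]
  [IsLocallyNoetherian X] {r : ℕ}

theorem divFun_nonneg_of_isRegularAt (Y : PrimeDivisor X) {f : X.functionField}
    (hf : IsRegularAt Y.1 f) : 0 ≤ divFun f Y := by
  obtain ⟨g, rfl⟩ := hf
  by_cases hg : g = 0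
  · rw [hg, map_zero, divFun, Scheme.ord_zero]
    rfl
  have hg' : toFun Y.1 g ≠ 0 := by
    rwa [Ne, map_eq_zero_iff _ (IsFractionRing.injective _ X.functionField)]
  have : Ring.KrullDimLE 1 (X.presheaf.stalk Y.1) := krullDimLE_of_coheight_le Y.2.le
  rw [divFun, Scheme.le_ord_iff Y.2 hg']
  exact Ring.ordFrac_ge_one_of_ne_zero hg

theorem divFun_inv (Y : PrimeDivisor X) {f : X.functionField} (hf : f ≠ 0) :
    divFun f⁻¹ Y = -divFun f Y := by
  have h := Scheme.ord_mul (x := Y.1) hf (inv_ne_zero hf)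
  have h1 : X.ord (1 : X.functionField) Y.1 = 0 := by
    have := Scheme.ord_mul (x := Y.1) (one_ne_zero (α := X.functionField)) one_ne_zero
    rw [mul_one] at this
    omega
  rw [mul_inv_cancel₀ hf, h1] at h
  simp only [divFun]
  omega

theorem divFun_mul (Y : PrimeDivisor X) {f g : X.functionField} (hf : f ≠ 0) (hg : g ≠ 0) :
    divFun (f * g) Y = divFun f Y + divFun g Y :=
  Scheme.ord_mul hf hg

theorem divFun_of_isUnit (Y : PrimeDivisor X) {u : X.presheaf.stalk Y.1} (hu : IsUnit u) :
    divFun (toFun Y.1 u) Y = 0 := by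
  obtain ⟨u, rfl⟩ := hu
  have h0 : toFun Y.1 (u : X.presheaf.stalk Y.1) ≠ 0 := by
    rw [Ne, map_eq_zero_iff _ (IsFractionRing.injective _ X.functionField)]
    exact u.ne_zero
  have h1 := divFun_nonneg_of_isRegularAt Y ⟨(u : X.presheaf.stalk Y.1), rfl⟩
  have h2 := divFun_nonneg_of_isRegularAt Y ⟨((u⁻¹ : (X.presheaf.stalk Y.1)ˣ) : _), rfl⟩
  have h3 : toFun Y.1 ((u⁻¹ : (X.presheaf.stalk Y.1)ˣ) : X.presheaf.stalk Y.1) =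
      (toFun Y.1 (u : X.presheaf.stalk Y.1))⁻¹ :=
    eq_inv_of_mul_eq_one_left (by rw [← map_mul, Units.inv_mul, map_one])
  rw [h3, divFun_inv Y h0] at h2
  omega

theorem isDiscreteValuationRing_stalk
    [SmoothOfRelativeDimension r (X ↘ Spec (CommRingCat.of k))] (Y : PrimeDivisor X) :
    IsDiscreteValuationRing (X.presheaf.stalk Y.1) := by
  obtain ⟨W, hYW, hW⟩ := exists_isChart (k := k) (r := r) Y.1
  have : Nonempty W := ⟨⟨Y.1, hYW⟩⟩
  let : Algebra Γ(X, W) (X.presheaf.stalk Y.1) := (X.presheaf.germ W Y.1 hYW).hom.toAlgebra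
  have : IsLocalization.AtPrime (X.presheaf.stalk Y.1)
      (hW.isAffineOpen.primeIdealOf ⟨Y.1, hYW⟩).asIdeal :=
    hW.isAffineOpen.isLocalization_stalk ⟨Y.1, hYW⟩
  have := hW.isIntegrallyClosed
  have h1 : IsIntegrallyClosed (X.presheaf.stalk Y.1) :=
    isIntegrallyClosed_of_isLocalization _
      (hW.isAffineOpen.primeIdealOf ⟨Y.1, hYW⟩).asIdeal.primeCompl
      (Ideal.primeCompl_le_nonZeroDivisors _)
  have : Ring.KrullDimLE 1 (X.presheaf.stalk Y.1) := krullDimLE_of_coheight_le Y.2.le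
  have hfield : ¬ IsField (X.presheaf.stalk Y.1) := by
    intro h
    have h2 := ringKrullDim_eq_zero_of_isField h
    rw [ringKrullDim_stalk_eq_coheight, Y.2] at h2
    exact one_ne_zero h2
  have hmax : IsLocalRing.maximalIdeal (X.presheaf.stalk Y.1) ≠ ⊥ :=
    IsLocalRing.isField_iff_maximalIdeal_eq.not.mp hfield
  have key : IsDiscreteValuationRing (X.presheaf.stalk Y.1) ↔
      IsIntegrallyClosed (X.presheaf.stalk Y.1) ∧
        ∃! q : Ideal (X.presheaf.stalk Y.1), q ≠ ⊥ ∧ q.IsPrime :=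
    (IsDiscreteValuationRing.TFAE (X.presheaf.stalk Y.1) hfield).out 0 3
  refine key.mpr ⟨h1, IsLocalRing.maximalIdeal _, ⟨hmax, inferInstance⟩, ?_⟩
  rintro q ⟨hq, hq'⟩
  exact IsLocalRing.eq_maximalIdeal (hq'.isMaximal_of_ne_bot hq)

variable (k r) in
/-- The local ring at the generic point of `Y` is the valuation ring of the order along `Y`. -/
theorem isRegularAt_of_divFun_nonneg
    [SmoothOfRelativeDimension r (X ↘ Spec (CommRingCat.of k))] (Y : PrimeDivisor X)
    {f : X.functionField} (hf : 0 ≤ divFun f Y) : IsRegularAt Y.1 f := by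
  by_cases hf0 : f = 0
  · exact ⟨0, by rw [hf0, map_zero]⟩
  have := isDiscreteValuationRing_stalk (k := k) (r := r) Y
  rw [divFun, Scheme.le_ord_iff Y.2 hf0] at hf
  change 1 ≤ Ring.ordFrac (X.presheaf.stalk Y.1) f at hf
  rw [Ring.ordFrac_eq_valuation_inv, one_le_inv₀ (by simpa [zero_lt_iff] using hf0)] at hf
  exact IsDiscreteValuationRing.exists_lift_of_le_one hf

variable (k r) in
theorem one_le_divFun_of_mem_maximalIdeal
    [SmoothOfRelativeDimension r (X ↘ Spec (CommRingCat.of k))] (Y : PrimeDivisor X)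
    {g : X.presheaf.stalk Y.1} (hg0 : g ≠ 0)
    (hg : g ∈ IsLocalRing.maximalIdeal (X.presheaf.stalk Y.1)) :
    1 ≤ divFun (toFun Y.1 g) Y := by
  have h0 : toFun Y.1 g ≠ 0 := by
    rwa [Ne, map_eq_zero_iff _ (IsFractionRing.injective _ X.functionField)]
  by_contra hlt
  have h1 : 0 ≤ divFun (toFun Y.1 g)⁻¹ Y := by
    rw [divFun_inv Y h0]; omega
  obtain ⟨g', hg'⟩ := isRegularAt_of_divFun_nonneg k r Y h1
  refine (IsLocalRing.mem_maximalIdeal g).mp hg (IsUnit.of_mul_eq_one g' ?_)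
  apply IsFractionRing.injective (X.presheaf.stalk Y.1) X.functionField
  rw [map_mul, map_one]
  change toFun Y.1 g * toFun Y.1 g' = 1
  rw [hg', mul_inv_cancel₀ h0]

variable (k r) in
/-- Hartogs: a rational function without poles along the prime divisors through `P` is regular
at `P`. -/
theorem isRegularAt_of_forall_divFun_nonneg
    [SmoothOfRelativeDimension r (X ↘ Spec (CommRingCat.of k))] (P : X) {f : X.functionField}
    (hf : ∀ Y : PrimeDivisor X, P ∈ closure {Y.1} → 0 ≤ divFun f Y) : IsRegularAt P f := by
  obtain ⟨W, hPW, hW⟩ := exists_isChart (k := k) (r := r) P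
  have : Nonempty W := ⟨⟨P, hPW⟩⟩
  have hA := hW.isAffineOpen
  have := functionField_isFractionRing_of_isAffineOpen X W hA
  have := hW.isIntegrallyClosed
  have : IsNoetherianRing Γ(X, W) := IsLocallyNoetherian.component_noetherian ⟨W, hA⟩
  -- An element outside the prime of a point is a unit in the local ring there.
  have hunit : ∀ (Q : X) (hQ : Q ∈ W) (s : Γ(X, W)),
      s ∉ (hA.primeIdealOf ⟨Q, hQ⟩).asIdeal → IsUnit (X.presheaf.germ W Q hQ s) := by
    intro Q hQ s hs
    let : Algebra Γ(X, W) (X.presheaf.stalk Q) := (X.presheaf.germ W Q hQ).hom.toAlgebra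
    have : IsLocalization.AtPrime (X.presheaf.stalk Q) (hA.primeIdealOf ⟨Q, hQ⟩).asIdeal :=
      hA.isLocalization_stalk ⟨Q, hQ⟩
    exact IsLocalization.map_units (X.presheaf.stalk Q) (⟨s, hs⟩ :
      (hA.primeIdealOf ⟨Q, hQ⟩).asIdeal.primeCompl)
  obtain ⟨s, hs, b, hb⟩ := exists_notMem_smul_mem_of_height_one
    (hA.primeIdealOf ⟨P, hPW⟩).asIdeal f (by
      intro q hq hqP hht
      let y : Spec Γ(X, W) := ⟨q, hq⟩
      have hyW : hA.fromSpec y ∈ W := by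
        have := hA.range_fromSpec ▸ Set.mem_range_self (f := hA.fromSpec) y
        exact this
      let Y : PrimeDivisor X := ⟨hA.fromSpec y, by
        rw [coheight_eq_of_isOpenImmersion, ← idealHeight_eq_coheight]
        exact hht⟩
      have hYP : P ∈ closure {Y.1} := by
        rw [← specializes_iff_mem_closure]
        have h1 : y ⤳ hA.primeIdealOf ⟨P, hPW⟩ := (PrimeSpectrum.le_iff_specializes _ _).mp hqP
        have h2 := h1.map hA.fromSpec.continuous
        rwa [hA.fromSpec_primeIdealOf] at h2
      obtain ⟨g, hg⟩ := isRegularAt_of_divFun_nonneg k r Y (hf Y hYP)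
      let : Algebra Γ(X, W) (X.presheaf.stalk Y.1) := (X.presheaf.germ W Y.1 hyW).hom.toAlgebra
      have hloc : IsLocalization.AtPrime (X.presheaf.stalk Y.1) q := hA.isLocalization_stalk' y hyW
      obtain ⟨⟨b, s⟩, hbs⟩ := IsLocalization.surj q.primeCompl g
      refine ⟨s, s.2, b, ?_⟩
      have := congrArg (toFun Y.1) hbs
      rw [map_mul, hg, mul_comm] at this
      have hgerm : ∀ t : Γ(X, W), toFun Y.1 (algebraMap Γ(X, W) (X.presheaf.stalk Y.1) t) =
          algebraMap Γ(X, W) X.functionField t := fun t =>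
        X.algebraMap_germ_eq_germToFunctionField hyW t
      rw [← hgerm, ← hgerm]
      exact this)
  obtain ⟨u, hu⟩ := hunit P hPW s hs
  have hgerm : ∀ t : Γ(X, W), toFun P (X.presheaf.germ W P hPW t) =
      algebraMap Γ(X, W) X.functionField t := fun t =>
    X.algebraMap_germ_eq_germToFunctionField hPW t
  refine ⟨X.presheaf.germ W P hPW b * ((u⁻¹ : (X.presheaf.stalk P)ˣ) : X.presheaf.stalk P), ?_⟩
  rw [map_mul, hgerm, ← hb, ← hgerm, ← hu, mul_comm, ← mul_assoc, ← map_mul, Units.inv_mul,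
    map_one, one_mul]

end Orders

/-! ### Divisors of rational differential forms -/

theorem exists_isCoordinates (k : Type u) [Field k] {X : Scheme.{u}}
    [X.Over (Spec (CommRingCat.of k))] (r : ℕ)
    [SmoothOfRelativeDimension r (X ↘ Spec (CommRingCat.of k))] (P : X) :
    ∃ x : Fin r → X.presheaf.stalk P, IsCoordinates k x := by
  obtain ⟨W, hPW, hW⟩ := exists_isChart (k := k) (r := r) P
  have : Nonempty W := ⟨⟨P, hPW⟩⟩
  obtain ⟨t, ht⟩ := hW.exists_isCoordinates
  exact ⟨_, ht P hPW⟩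

section FormDivisors

variable {k : Type u} [Field k] {X : Scheme.{u}} [X.Over (Spec (CommRingCat.of k))]
  [IsIntegral X] {r : ℕ}

theorem toFun_injective (P : X) : Function.Injective (toFun P) :=
  IsFractionRing.injective (X.presheaf.stalk P) X.functionField

/-- Two nonzero generators at a point differ by a unit. -/
theorem IsGenerator.exists_eq_unit_smul {P : X} {ω₁ ω₂ : RatForm k X r} (h₁ : IsGenerator P ω₁)
    (h₂ : IsGenerator P ω₂) (h0 : ω₁ ≠ 0) :
    ∃ u : (X.presheaf.stalk P)ˣ, ω₁ = toFun P u • ω₂ := by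
  have m₁ : ω₁ ∈ regularForms k r P := (h₁ ω₁).mpr ⟨1, by rw [map_one, one_smul]⟩
  have m₂ : ω₂ ∈ regularForms k r P := (h₂ ω₂).mpr ⟨1, by rw [map_one, one_smul]⟩
  obtain ⟨a, ha⟩ := (h₂ ω₁).mp m₁
  obtain ⟨b, hb⟩ := (h₁ ω₂).mp m₂
  have hab : a * b = 1 := by
    apply toFun_injective P
    rw [map_mul, map_one]
    apply smul_left_injective X.functionField h0
    change (toFun P a * toFun P b) • ω₁ = (1 : X.functionField) • ω₁
    rw [mul_smul, ← hb, ← ha, one_smul]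
  exact ⟨⟨a, b, hab, by rw [mul_comm, hab]⟩, ha⟩

theorem IsCoordinates.exists_eq_unit_smul {P : X} {x y : Fin r → X.presheaf.stalk P}
    (hx : IsCoordinates k x) (hy : IsCoordinates k y) :
    ∃ u : (X.presheaf.stalk P)ˣ, dWedge k (fun i => toFun P (x i)) =
      toFun P u • dWedge k (fun i => toFun P (y i)) :=
  hx.isGenerator.exists_eq_unit_smul hy.isGenerator hx.dWedge_ne_zero

variable [IsLocallyNoetherian X]

/-- The order of a form along `Y` may be computed from any generator at the generic point
of `Y`. -/
theorem divForm_smul_of_isGenerator (Y : PrimeDivisor X) {ω₀ : RatForm k X r}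
    (hω : IsGenerator Y.1 ω₀) (h0 : ω₀ ≠ 0) (h : X.functionField) :
    divForm (h • ω₀) Y = divFun h Y := by
  have H : ∃ h' : X.functionField, ∃ ω₁ : RatForm k X r,
      IsGenerator Y.1 ω₁ ∧ h • ω₀ = h' • ω₁ := ⟨h, ω₀, hω, rfl⟩
  rw [divForm, dif_pos H]
  obtain ⟨ω₁, hω₁, he⟩ := H.choose_spec
  obtain ⟨u, hu⟩ := hω.exists_eq_unit_smul hω₁ h0
  have h1 : ω₁ ≠ 0 := by
    rintro rfl
    exact h0 (by rw [hu, smul_zero])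
  have h2 : H.choose = h * toFun Y.1 u := by
    apply smul_left_injective X.functionField h1
    change H.choose • ω₁ = (h * toFun Y.1 u) • ω₁
    rw [mul_smul, ← hu, ← he]
  rw [h2]
  change divFun (h * toFun Y.1 u) Y = _
  by_cases hh : h = 0
  · rw [hh, zero_mul]
  · have hu0 : toFun Y.1 (u : X.presheaf.stalk Y.1) ≠ 0 := by
      intro h
      exact u.ne_zero ((map_eq_zero_iff _ (toFun_injective Y.1)).mp h)
    rw [divFun_mul Y hh hu0, divFun_of_isUnit Y u.isUnit, add_zero]

/-- A unit of the local ring at `P` has order zero along the prime divisors through `P`. -/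
theorem divFun_of_isUnit_of_mem_closure {P : X} {u : X.presheaf.stalk P} (hu : IsUnit u)
    {Y : PrimeDivisor X} (hY : P ∈ closure {Y.1}) : divFun (toFun P u) Y = 0 := by
  rw [← toFun_stalkSpecializes (specializes_iff_mem_closure.mpr hY) u]
  exact divFun_of_isUnit Y (hu.map (X.presheaf.stalkSpecializes _).hom)

variable [SmoothOfRelativeDimension r (X ↘ Spec (CommRingCat.of k))]

theorem divForm_smul (Y : PrimeDivisor X) {f : X.functionField} (hf : f ≠ 0)
    {ω : RatForm k X r} (hω : ω ≠ 0) : divForm (f • ω) Y = divFun f Y + divForm ω Y := by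
  obtain ⟨x, hx⟩ := exists_isCoordinates k r Y.1
  obtain ⟨h, rfl⟩ := hx.exists_eq_smul ω
  have hh : h ≠ 0 := by
    rintro rfl
    exact hω (zero_smul _ _)
  rw [← mul_smul, divForm_smul_of_isGenerator Y hx.isGenerator hx.dWedge_ne_zero,
    divForm_smul_of_isGenerator Y hx.isGenerator hx.dWedge_ne_zero, divFun_mul Y hf hh]

/-- For coordinates `x` at `P`, the form `dx₁ ∧ ⋯ ∧ dx_r` has order zero along the prime divisors
through `P`. -/
theorem IsCoordinates.divForm_dWedge {P : X} {x : Fin r → X.presheaf.stalk P}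
    (hx : IsCoordinates k x) {Y : PrimeDivisor X} (hY : P ∈ closure {Y.1}) :
    divForm (dWedge k (fun i => toFun P (x i))) Y = 0 := by
  obtain ⟨W, hPW, hW⟩ := exists_isChart (k := k) (r := r) P
  have : Nonempty W := ⟨⟨P, hPW⟩⟩
  obtain ⟨t, ht⟩ := hW.exists_isCoordinates
  obtain ⟨u, hu⟩ := hx.exists_eq_unit_smul (ht P hPW)
  have hYW : Y.1 ∈ W := (specializes_iff_mem_closure.mpr hY).mem_open W.2 hPW
  have h1 : (fun i => toFun P (X.presheaf.germ W P hPW (t i))) =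
      fun i => toFun Y.1 (X.presheaf.germ W Y.1 hYW (t i)) :=
    funext fun i => toFun_germ hPW hYW (t i)
  rw [hu, h1, divForm_smul_of_isGenerator Y (ht Y.1 hYW).isGenerator
    (ht Y.1 hYW).dWedge_ne_zero]
  exact divFun_of_isUnit_of_mem_closure u.isUnit hY

end FormDivisors

/-! ### Finiteness of supports -/

section Finiteness

variable {X : Scheme.{u}} [IsIntegral X]

/-- On an integral Noetherian scheme, only finitely many prime divisors miss a given nonempty open
set: they are among the components of its complement. -/
theorem finite_primeDivisor_notMem [TopologicalSpace.NoetherianSpace X] (U : X.Opens)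
    [hU : Nonempty U] : {Y : PrimeDivisor X | Y.1 ∉ U}.Finite := by
  obtain ⟨S, hS, hcl, hirr, hSup⟩ :=
    TopologicalSpace.NoetherianSpace.exists_finite_set_isClosed_irreducible
      (s := (U : Set X)ᶜ) U.2.isClosed_compl
  have hcov : ∀ y ∉ U, ∃ t ∈ S, y ∈ t := fun y hy => by
    have h1 : y ∈ (U : Set X)ᶜ := hy
    rwa [hSup] at h1
  have hsub : ∀ t ∈ S, ∀ y ∈ t, y ∉ U := fun t ht y hy => by
    have h1 : y ∈ (U : Set X)ᶜ := by rw [hSup]; exact ⟨t, ht, hy⟩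
    exact h1
  choose! T hTS hT using hcov
  refine Set.Finite.of_finite_image (f := fun Y : PrimeDivisor X => T Y.1)
    (hS.subset ?_) ?_
  · rintro _ ⟨Y, hY, rfl⟩
    exact hTS Y.1 hY
  · -- a prime divisor contained in a component of the complement is this component
    have key : ∀ Y : PrimeDivisor X, Y.1 ∉ U → IsGenericPoint Y.1 (T Y.1) := by
      intro Y hY
      obtain ⟨c, hc⟩ := QuasiSober.sober (hirr _ (hTS Y.1 hY)) (hcl _ (hTS Y.1 hY))
      have hcY : c ⤳ Y.1 := hc.specializes (hT Y.1 hY)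
      by_cases hYc : Y.1 ⤳ c
      · have hEq : Y.1 = c := (hYc.antisymm hcY).eq
        change closure {Y.1} = T Y.1
        have h : closure {Y.1} = closure {c} := by rw [hEq]
        exact h.trans hc
      exfalso
      have hcU : c ∉ U := hsub _ (hTS Y.1 hY) c hc.mem
      have hgc : ¬ c ⤳ genericPoint X := by
        intro h
        obtain ⟨⟨z, hz⟩⟩ := hU
        exact hcU ((h.trans (genericPoint_specializes z)).mem_open U.2 hz)
      have h1 : Order.coheight c + 1 ≤ Order.coheight Y.1 :=
        Order.coheight_add_one_le (lt_of_le_not_ge hcY hYc)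
      have h2 : Order.coheight (genericPoint X) + 1 ≤ Order.coheight c :=
        Order.coheight_add_one_le (lt_of_le_not_ge (genericPoint_specializes c) hgc)
      rw [Y.2] at h1
      have h3 : (2 : ℕ∞) ≤ 1 := calc
        (2 : ℕ∞) = 0 + 1 + 1 := by norm_num
        _ ≤ Order.coheight (genericPoint X) + 1 + 1 := by gcongr; exact zero_le
        _ ≤ Order.coheight c + 1 := by gcongr
        _ ≤ 1 := h1
      exact absurd h3 (by norm_num)
    intro Y hY Z hZ h
    have hZ' := key Z hZ
    rw [← show T Y.1 = T Z.1 from h] at hZ'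
    exact Subtype.ext ((key Y hY).eq hZ')

variable [IsLocallyNoetherian X] [TopologicalSpace.NoetherianSpace X]

theorem finite_divFun_ne_zero (f : X.functionField) : {Y | divFun f Y ≠ 0}.Finite := by
  by_cases hf : f = 0
  · rw [hf]
    convert Set.finite_empty
    rw [Set.eq_empty_iff_forall_notMem]
    intro Y hY
    refine hY ?_
    rw [divFun, Scheme.ord_zero]
    rfl
  obtain ⟨U, -, f', hU, rfl, hf'⟩ := exists_isUnit_germ_eq X f hf
  exact (finite_primeDivisor_notMem U).subset fun Y hY hYU => hY (Scheme.ord_of_isUnit hf' hYU)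

variable {k : Type u} [Field k] [X.Over (Spec (CommRingCat.of k))] {r : ℕ}
  [SmoothOfRelativeDimension r (X ↘ Spec (CommRingCat.of k))]

/-- On a chart the divisor of a form is that of a rational function. -/
theorem finite_divForm_ne_zero (ω : RatForm k X r) : {Y | divForm ω Y ≠ 0}.Finite := by
  obtain ⟨W, hPW, hW⟩ := exists_isChart (k := k) (r := r) (genericPoint X)
  have : Nonempty W := ⟨⟨_, hPW⟩⟩
  obtain ⟨t, ht⟩ := hW.exists_isCoordinates
  obtain ⟨h, rfl⟩ := (ht _ hPW).exists_eq_smul ω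
  refine ((finite_primeDivisor_notMem W).union (finite_divFun_ne_zero h)).subset fun Y hY => ?_
  by_cases hYW : Y.1 ∈ W
  · refine Or.inr fun hh => hY ?_
    have h1 : (fun i => toFun _ (X.presheaf.germ W _ hPW (t i))) =
        fun i => toFun Y.1 (X.presheaf.germ W Y.1 hYW (t i)) :=
      funext fun i => toFun_germ hPW hYW (t i)
    rw [h1, divForm_smul_of_isGenerator Y (ht Y.1 hYW).isGenerator
      (ht Y.1 hYW).dWedge_ne_zero, hh]
  · exact Or.inl hYW

end Finiteness

section Compactness

theorem IsProjective.compactSpace {k : Type u} [Field k] {X : Scheme.{u}}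
    [X.Over (Spec (CommRingCat.of k))] (h : IsProjective k X) : CompactSpace X := by
  obtain ⟨N, i, hi, hi'⟩ := h
  have : IsScalarTower k (homogeneousPolys k N 0) (MvPolynomial (Fin (N + 1)) k) :=
    IsScalarTower.of_algebraMap_eq (R := k) (S := homogeneousPolys k N 0)
      (A := MvPolynomial (Fin (N + 1)) k) fun _ => rfl
  have : Algebra.FiniteType (homogeneousPolys k N 0) (MvPolynomial (Fin (N + 1)) k) :=
    Algebra.FiniteType.of_restrictScalars_finiteType k _ _
  have : CompactSpace (Proj (homogeneousPolys k N)) := by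
    exact QuasiCompact.compactSpace_of_compactSpace (Proj.toSpecZero (homogeneousPolys k N))
  exact QuasiCompact.compactSpace_of_compactSpace i

end Compactness

/-! ### Affine neighbourhoods of finitely many points -/

section AffineNeighbourhoods

/-- Homogeneous prime avoidance: a homogeneous element of positive degree outside finitely many
relevant homogeneous primes that are pairwise incomparable. -/
theorem exists_homogeneous_notMem {A σ : Type*} [CommRing A] [SetLike σ A]
    [AddSubgroupClass σ A] (𝒜 : ℕ → σ) [GradedRing 𝒜] {n : ℕ}
    (p : Fin n → ProjectiveSpectrum 𝒜) (hp : ∀ i j, i ≠ j → ¬ p j ≤ p i) :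
    ∃ m, 0 < m ∧ ∃ F ∈ 𝒜 m, ∀ i, F ∉ (p i).asHomogeneousIdeal := by
  classical
  have h1 : ∀ i j, i ≠ j → ∃ d, ∃ f ∈ 𝒜 d, f ∈ (p j).asHomogeneousIdeal ∧
      f ∉ (p i).asHomogeneousIdeal := by
    intro i j hij
    obtain ⟨f, hfj, hfi⟩ := SetLike.not_le_iff_exists.mp
      (show ¬ (p j).asHomogeneousIdeal ≤ (p i).asHomogeneousIdeal from hp i j hij)
    by_contra! hcon
    refine hfi (((p i).asHomogeneousIdeal.isHomogeneous.mem_iff _).mpr fun d => ?_)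
    exact hcon d _ (SetLike.coe_mem _) ((p j).asHomogeneousIdeal.isHomogeneous d hfj)
  have h2 : ∀ i, ∃ d, 0 < d ∧ ∃ f ∈ 𝒜 d, f ∉ (p i).asHomogeneousIdeal := by
    intro i
    obtain ⟨f, hf, hfi⟩ := SetLike.not_le_iff_exists.mp (p i).not_irrelevant_le
    by_contra! hcon
    refine hfi (((p i).asHomogeneousIdeal.isHomogeneous.mem_iff _).mpr fun d => ?_)
    rcases Nat.eq_zero_or_pos d with rfl | hd
    · rw [HomogeneousIdeal.mem_irrelevant_iff, GradedRing.proj_apply] at hf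
      rw [hf]
      exact zero_mem _
    · exact hcon d hd _ (SetLike.coe_mem _)
  -- an element of positive degree vanishing at all points but one
  have h3 : ∀ i, ∃ d, 0 < d ∧ ∃ f ∈ 𝒜 d, f ∉ (p i).asHomogeneousIdeal ∧
      ∀ j, j ≠ i → f ∈ (p j).asHomogeneousIdeal := by
    intro i
    have h1' : ∀ j, ∃ d, ∃ f ∈ 𝒜 d, (j ≠ i → f ∈ (p j).asHomogeneousIdeal) ∧
        f ∉ (p i).asHomogeneousIdeal := by
      intro j
      by_cases hij : i = j
      · exact ⟨0, 1, SetLike.GradedOne.one_mem, fun h => absurd hij.symm h,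
          (p i).isPrime.one_notMem⟩
      · obtain ⟨d, f, hf, h, h'⟩ := h1 i j hij
        exact ⟨d, f, hf, fun _ => h, h'⟩
    choose d f hf hfj hfi using h1'
    obtain ⟨e, he, g, hg, hgi⟩ := h2 i
    refine ⟨e + ∑ j, d j, by omega, g * ∏ j, f j,
      SetLike.GradedMul.mul_mem hg (SetLike.prod_mem_graded _ _ _ fun j _ => hf j), ?_, ?_⟩
    · intro h
      rcases (p i).isPrime.mem_or_mem h with h | h
      · exact hgi h
      · obtain ⟨j, -, hj⟩ := (Ideal.IsPrime.prod_mem_iff (hp := (p i).isPrime)).mp h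
        exact hfi j hj
    · intro j hj
      exact Ideal.mul_mem_left _ _ (Ideal.mem_of_dvd _ (Finset.dvd_prod_of_mem f
        (Finset.mem_univ j)) (hfj j hj))
  choose d hd f hf hfi hfj using h3
  have hpos : ∀ i, 0 < ∏ j ∈ Finset.univ.erase i, d j := fun i =>
    Finset.prod_pos fun j _ => hd j
  refine ⟨∏ j, d j, Finset.prod_pos fun j _ => hd j,
    ∑ i, f i ^ (∏ j ∈ Finset.univ.erase i, d j), ?_, ?_⟩
  · refine sum_mem fun i _ => ?_
    have := SetLike.pow_mem_graded (∏ j ∈ Finset.univ.erase i, d j) (hf i)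
    rwa [smul_eq_mul, mul_comm, Finset.mul_prod_erase _ _ (Finset.mem_univ i)] at this
  · intro i h
    rw [← Finset.add_sum_erase _ _ (Finset.mem_univ i)] at h
    have h4 : ∑ l ∈ Finset.univ.erase i, f l ^ (∏ j ∈ Finset.univ.erase l, d j) ∈
        (p i).asHomogeneousIdeal.toIdeal := by
      refine sum_mem fun l hl => Ideal.pow_mem_of_mem _ (hfj l i ?_) _ (hpos l)
      exact (Finset.ne_of_mem_erase hl).symm
    exact hfi i ((p i).isPrime.mem_of_pow_mem _
      ((Submodule.add_mem_iff_left (p := (p i).asHomogeneousIdeal.toIdeal) h4).mp h))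

variable {k : Type u} [Field k] {X : Scheme.{u}} [X.Over (Spec (CommRingCat.of k))]

/-- Finitely many points of a projective scheme without specializations among them lie in an affine
open set, the complement of a hypersurface. -/
theorem IsProjective.exists_isAffineOpen (h : IsProjective k X) {n : ℕ} (P : Fin n → X)
    (hP : ∀ i j, i ≠ j → ¬ P j ⤳ P i) : ∃ W : X.Opens, IsAffineOpen W ∧ ∀ i, P i ∈ W := by
  obtain ⟨N, f, hf, -⟩ := h
  obtain ⟨m, hm, F, hF, hFP⟩ := exists_homogeneous_notMem (homogeneousPolys k N)
    (fun i => f (P i)) (by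
      intro i j hij hle
      refine hP i j hij ?_
      rw [← hf.isClosedEmbedding.isInducing.specializes_iff, specializes_iff_mem_closure]
      exact (ProjectiveSpectrum.le_iff_mem_closure (homogeneousPolys k N) _ _).mp hle)
  exact ⟨f ⁻¹ᵁ Proj.basicOpen (homogeneousPolys k N) F,
    (Proj.isAffineOpen_basicOpen _ F hF hm).preimage f, hFP⟩

theorem stalkSpecializes_algebraMap {P Q : X} (h : Q ⤳ P) (c : k) :
    X.presheaf.stalkSpecializes h (algebraMap k (X.presheaf.stalk P) c) =
      algebraMap k (X.presheaf.stalk Q) c := by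
  change X.presheaf.stalkSpecializes h (structureMap k X P c) = structureMap k X Q c
  simp only [structureMap, CommRingCat.hom_comp, RingHom.comp_apply]
  exact TopCat.Presheaf.germ_stalkSpecializes_apply X.presheaf _ _ _

/-- There are no specializations from a rational point to other points. -/
theorem IsRationalPoint.eq_of_specializes {P Q : X} (hQ : IsRationalPoint k Q)
    (h : Q ⤳ P) : Q = P := by
  refine (h.antisymm (specializes_iff_forall_open.mpr fun V hV hQV => ?_)).eq
  obtain ⟨_, ⟨W, hW, rfl⟩, hPW, -⟩ :=
    X.isBasis_affineOpens.exists_subset_of_mem_open (Set.mem_univ P) isOpen_univ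
  have hQW : Q ∈ W := h.mem_open W.2 hPW
  obtain ⟨f, hfV, hQf⟩ := hW.exists_basicOpen_le (V := ⟨V, hV⟩) ⟨Q, hQV⟩ hQW
  refine hfV ?_
  rw [Scheme.mem_basicOpen X f P hPW]
  rw [Scheme.mem_basicOpen X f Q hQW] at hQf
  by_contra hP
  obtain ⟨c, hc⟩ := exists_sub_algebraMap_mem_maximalIdeal hQ.surjective
    (X.presheaf.germ W Q hQW f)
  have h1 : X.presheaf.germ W P hPW f - algebraMap k _ c ∈ IsLocalRing.maximalIdeal _ := by
    rw [IsLocalRing.mem_maximalIdeal] at hc ⊢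
    refine fun hu => hc ?_
    have h2 := hu.map (X.presheaf.stalkSpecializes h).hom
    rw [map_sub] at h2
    have h3 : (X.presheaf.stalkSpecializes h).hom (X.presheaf.germ W P hPW f) =
        X.presheaf.germ W Q hQW f := TopCat.Presheaf.germ_stalkSpecializes_apply X.presheaf _ _ _
    have h4 : (X.presheaf.stalkSpecializes h).hom (algebraMap k _ c) = algebraMap k _ c :=
      stalkSpecializes_algebraMap h c
    rwa [h3, h4] at h2
  have h2 : algebraMap k (X.presheaf.stalk P) c ∈ IsLocalRing.maximalIdeal _ := by
    have := Ideal.sub_mem _ ((IsLocalRing.mem_maximalIdeal _).mpr hP) h1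
    rwa [sub_sub_cancel] at this
  have h3 : c = 0 := by
    by_contra hc0
    exact (IsLocalRing.mem_maximalIdeal _).mp h2 ((isUnit_iff_ne_zero.mpr hc0).map _)
  rw [h3, map_zero, sub_zero] at hc
  exact (IsLocalRing.mem_maximalIdeal _).mp hc hQf

end AffineNeighbourhoods

/-! ### Gluing rational functions at finitely many points -/

section Gluing

variable {X : Scheme.{u}} [IsIntegral X] [IsLocallyNoetherian X]

theorem divFun_one (Y : PrimeDivisor X) : divFun (1 : X.functionField) Y = 0 := by
  rw [← map_one (toFun Y.1)]
  exact divFun_of_isUnit Y isUnit_one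

theorem divFun_pow (Y : PrimeDivisor X) {f : X.functionField} (hf : f ≠ 0) (m : ℕ) :
    divFun (f ^ m) Y = m * divFun f Y := by
  induction m with
  | zero => rw [pow_zero, divFun_one]; simp
  | succ m ih =>
    rw [pow_succ, divFun_mul Y (pow_ne_zero m hf) hf, ih]
    push_cast
    ring

variable [TopologicalSpace.NoetherianSpace X]

/-- If `h` has order zero along the prime divisors through both `P` and `Q`, then its poles at `Q`
can be removed, and a zero at `Q` introduced, by a section that does not vanish at `P`. -/
theorem exists_isUnit_germ_mul_mem_maximalIdeal (k : Type u) [Field k]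
    [X.Over (Spec (CommRingCat.of k))] (r : ℕ)
    [SmoothOfRelativeDimension r (X ↘ Spec (CommRingCat.of k))] {W : X.Opens}
    (hW : IsAffineOpen W) {P Q : X}
    (hP : P ∈ W) (hQ : Q ∈ W) (hPQ : ¬ Q ⤳ P) {h : X.functionField} (h0 : h ≠ 0)
    (hh : ∀ Y : PrimeDivisor X, P ∈ closure {Y.1} → Q ∈ closure {Y.1} → divFun h Y = 0) :
    ∃ s : Γ(X, W), IsUnit (X.presheaf.germ W P hP s) ∧
      ∃ m ∈ IsLocalRing.maximalIdeal (X.presheaf.stalk Q),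
        toFun Q m = toFun Q (X.presheaf.germ W Q hQ s) * h := by
  have hsep : ∀ Z : X, P ∉ closure {Z} →
      ∃ t : Γ(X, W), IsUnit (X.presheaf.germ W P hP t) ∧ Z ∉ X.basicOpen t := by
    intro Z hZ
    obtain ⟨t, ht, htP⟩ := hW.exists_basicOpen_le
      (V := ⟨(closure {Z})ᶜ, isClosed_closure.isOpen_compl⟩) ⟨P, hZ⟩ hP
    exact ⟨t, (Scheme.mem_basicOpen X t P hP).mp htP, fun h => ht h (subset_closure rfl)⟩
  have hfin : {Y : PrimeDivisor X | divFun h Y ≠ 0 ∧ P ∉ closure {Y.1}}.Finite :=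
    (finite_divFun_ne_zero h).subset fun Y hY => hY.1
  have ht : ∀ Y : PrimeDivisor X, ∃ t : Γ(X, W), IsUnit (X.presheaf.germ W P hP t) ∧
      (P ∉ closure {Y.1} → Y.1 ∉ X.basicOpen t) := by
    intro Y
    by_cases hY : P ∈ closure {Y.1}
    · exact ⟨1, by rw [map_one]; exact isUnit_one, fun h => absurd hY h⟩
    · obtain ⟨t, h1, h2⟩ := hsep Y.1 hY
      exact ⟨t, h1, fun _ => h2⟩
  choose t htP htY using ht
  obtain ⟨t₀, ht₀P, ht₀Q⟩ := hsep Q (fun hQP => hPQ (specializes_iff_mem_closure.mpr hQP))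
  -- `s` vanishes along each `Y` that may carry a pole of `h` at `Q`, to at least the pole order
  let N : PrimeDivisor X → ℕ := fun Y => (divFun h Y).natAbs
  let s : Γ(X, W) := ∏ Y ∈ hfin.toFinset, t Y ^ N Y
  have hsP : IsUnit (X.presheaf.germ W P hP s) := by
    rw [map_prod, IsUnit.prod_iff]
    intro Y _
    rw [map_pow]
    exact (htP Y).pow _
  obtain ⟨m, hm⟩ : IsRegularAt Q (toFun Q (X.presheaf.germ W Q hQ s) * h) := by
    refine isRegularAt_of_forall_divFun_nonneg k r Q fun Y hY => ?_
    have hYW : Y.1 ∈ W := (specializes_iff_mem_closure.mpr hY).mem_open W.2 hQ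
    have hne : ∀ t : Γ(X, W), IsUnit (X.presheaf.germ W P hP t) →
        toFun Y.1 (X.presheaf.germ W Y.1 hYW t) ≠ 0 := by
      intro t ht h
      rw [toFun_germ hYW hP, map_eq_zero_iff _ (toFun_injective P)] at h
      exact ht.ne_zero h
    rw [toFun_germ hQ hYW]
    by_cases hY0 : divFun h Y = 0
    · rw [divFun_mul Y (hne s hsP) h0, hY0, add_zero]
      exact divFun_nonneg_of_isRegularAt Y ⟨_, rfl⟩
    have hPY : P ∉ closure {Y.1} := fun hPY => hY0 (hh Y hPY hY)
    have hmem : Y ∈ hfin.toFinset := hfin.mem_toFinset.mpr ⟨hY0, hPY⟩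
    obtain ⟨s', hs'⟩ := Finset.dvd_prod_of_mem (fun Y => t Y ^ N Y) hmem
    have hss : s = t Y ^ N Y * s' := hs'
    have hs'P : IsUnit (X.presheaf.germ W P hP s') := by
      rw [hss, map_mul] at hsP
      exact isUnit_of_mul_isUnit_right hsP
    have h1 : 1 ≤ divFun (toFun Y.1 (X.presheaf.germ W Y.1 hYW (t Y))) Y := by
      refine one_le_divFun_of_mem_maximalIdeal k r Y (fun h => hne _ (htP Y) ?_) ?_
      · rw [h, map_zero]
      · rw [IsLocalRing.mem_maximalIdeal]
        exact fun h => htY Y hPY ((Scheme.mem_basicOpen X _ _ hYW).mpr h)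
    have h2 : 0 ≤ divFun (toFun Y.1 (X.presheaf.germ W Y.1 hYW s')) Y :=
      divFun_nonneg_of_isRegularAt Y ⟨_, rfl⟩
    rw [divFun_mul Y (hne s hsP) h0, hss, map_mul, map_mul, map_pow, map_pow,
      divFun_mul Y (pow_ne_zero _ (hne _ (htP Y))) (hne _ hs'P), divFun_pow Y (hne _ (htP Y))]
    have h3 : (N Y : ℤ) ≤ N Y * divFun (toFun Y.1 (X.presheaf.germ W Y.1 hYW (t Y))) Y :=
      le_mul_of_one_le_right (Int.natCast_nonneg _) h1
    have h4 : -divFun h Y ≤ N Y := by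
      simp only [N, Int.natCast_natAbs]
      exact neg_le_abs _
    omega
  refine ⟨t₀ * s, by rw [map_mul]; exact ht₀P.mul hsP, X.presheaf.germ W Q hQ t₀ * m,
    Ideal.mul_mem_right _ _ ?_, by rw [map_mul, hm, map_mul, map_mul, mul_assoc]⟩
  rw [IsLocalRing.mem_maximalIdeal]
  exact fun h => ht₀Q ((Scheme.mem_basicOpen X _ _ hQ).mpr h)

/-- Rational functions `g i`, given at rational points `P i` and with the same order along each
prime divisor through two of these points, can be replaced by one rational function that
differs from each `g i` by a unit with a prescribed value at `P i`. -/
theorem exists_unit_mul_eq {k : Type u} [Field k] [X.Over (Spec (CommRingCat.of k))] (r : ℕ)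
    [SmoothOfRelativeDimension r (X ↘ Spec (CommRingCat.of k))] {W : X.Opens}
    (hW : IsAffineOpen W) {n : ℕ} {P : Fin n → X}
    (hPW : ∀ i, P i ∈ W) (hP : ∀ i, IsRationalPoint k (P i)) (hinj : Function.Injective P)
    {g : Fin n → X.functionField} (hg : ∀ i, g i ≠ 0)
    (hgY : ∀ i j, ∀ Y : PrimeDivisor X, P i ∈ closure {Y.1} → P j ∈ closure {Y.1} →
      divFun (g i) Y = divFun (g j) Y) {c : Fin n → k} (hc : ∀ i, c i ≠ 0) :
    ∃ f : X.functionField, f ≠ 0 ∧ ∀ i, ∃ e : X.presheaf.stalk (P i),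
      e - algebraMap k _ (c i) ∈ IsLocalRing.maximalIdeal _ ∧ f = toFun (P i) e * g i := by
  classical
  -- a multiple of `g i` with the prescribed value relative to `g i` at `P i`, and the value zero
  -- relative to `g j` at the other points `P j`; the sum of these functions solves the problem
  have key : ∀ i, ∃ f : X.functionField, ∀ j, ∃ e : X.presheaf.stalk (P j),
      f = toFun (P j) e * g j ∧
      (j = i → e - algebraMap k _ (c j) ∈ IsLocalRing.maximalIdeal _) ∧
      (j ≠ i → e ∈ IsLocalRing.maximalIdeal _) := by
    intro i
    have h1 : ∀ j, ∃ s : Γ(X, W), IsUnit (X.presheaf.germ W (P i) (hPW i) s) ∧ (j ≠ i →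
        ∃ m ∈ IsLocalRing.maximalIdeal (X.presheaf.stalk (P j)),
          toFun (P j) m = toFun (P j) (X.presheaf.germ W (P j) (hPW j) s) * (g i / g j)) := by
      intro j
      by_cases hij : j = i
      · exact ⟨1, by rw [map_one]; exact isUnit_one, fun h => absurd hij h⟩
      · obtain ⟨s, hs, hs'⟩ := exists_isUnit_germ_mul_mem_maximalIdeal k r hW (hPW i) (hPW j)
          (fun h => hij (hinj ((hP j).eq_of_specializes h)))
          (div_ne_zero (hg i) (hg j)) (fun Y hYi hYj => by
            rw [div_eq_mul_inv, divFun_mul Y (hg i) (inv_ne_zero (hg j)),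
              divFun_inv Y (hg j), hgY i j Y hYi hYj]
            omega)
        exact ⟨s, hs, fun _ => hs'⟩
    choose s hs hsj using h1
    have hS : IsUnit (X.presheaf.germ W (P i) (hPW i) (∏ j, s j)) := by
      rw [map_prod, IsUnit.prod_iff]
      exact fun j _ => hs j
    obtain ⟨b, hb⟩ := exists_sub_algebraMap_mem_maximalIdeal (hP i).surjective
      (X.presheaf.germ W (P i) (hPW i) (∏ j, s j))
    have hb0 : b ≠ 0 := by
      rintro rfl
      rw [map_zero, sub_zero] at hb
      exact (IsLocalRing.mem_maximalIdeal _).mp hb hS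
    let t : Γ(X, W) := sectionMap k X W (c i / b) * ∏ j, s j
    have hgt : ∀ j, X.presheaf.germ W (P j) (hPW j) t = algebraMap k _ (c i / b) *
        X.presheaf.germ W (P j) (hPW j) (∏ j, s j) := by
      intro j
      rw [map_mul, germ_sectionMap]
    refine ⟨toFun (P i) (X.presheaf.germ W (P i) (hPW i) t) * g i, fun j => ?_⟩
    by_cases hij : j = i
    · subst hij
      refine ⟨_, rfl, fun _ => ?_, fun h => absurd rfl h⟩
      rw [hgt]
      have h2 := Ideal.mul_mem_left _ (algebraMap k _ (c j / b)) hb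
      rwa [mul_sub, ← map_mul, div_mul_cancel₀ _ hb0] at h2
    · obtain ⟨m, hm, hm'⟩ := hsj j hij
      obtain ⟨s', hs'⟩ := Finset.dvd_prod_of_mem s (Finset.mem_univ j)
      refine ⟨algebraMap k _ (c i / b) * (X.presheaf.germ W (P j) (hPW j) s' * m), ?_,
        fun h => absurd h hij, fun _ => Ideal.mul_mem_left _ _ (Ideal.mul_mem_left _ _ hm)⟩
      rw [toFun_germ (hPW i) (hPW j), hgt, hs', map_mul, map_mul, map_mul, map_mul, map_mul, hm']
      field_simp [hg j]
  choose f e hf he he' using key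
  have hsum : ∀ j, (∑ i, e i j) - algebraMap k _ (c j) ∈
      IsLocalRing.maximalIdeal (X.presheaf.stalk (P j)) := by
    intro j
    rw [← Finset.add_sum_erase _ _ (Finset.mem_univ j), add_sub_right_comm]
    exact Ideal.add_mem _ (he j j rfl) (sum_mem fun i hi =>
      he' i j (Finset.ne_of_mem_erase hi).symm)
  have hfe : ∀ j, ∑ i, f i = toFun (P j) (∑ i, e i j) * g j := by
    intro j
    rw [map_sum, Finset.sum_mul]
    exact Finset.sum_congr rfl fun i _ => hf i j
  rcases isEmpty_or_nonempty (Fin n) with hn | ⟨⟨j⟩⟩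
  · exact ⟨1, one_ne_zero, fun i => hn.elim i⟩
  refine ⟨∑ i, f i, ?_, fun i => ⟨_, hsum i, hfe i⟩⟩
  rw [hfe j]
  refine mul_ne_zero (fun h => ?_) (hg j)
  have h1 := hsum j
  rw [(map_eq_zero_iff _ (toFun_injective (P j))).mp h, zero_sub, neg_mem_iff,
    IsLocalRing.mem_maximalIdeal] at h1
  exact h1 ((isUnit_iff_ne_zero.mpr (hc j)).map _)

end Gluing

/-! ### Residues at rational points -/

section ResidueFormula

theorem isUnit_of_sub_algebraMap_mem {k : Type u} [Field k] {X : Scheme.{u}}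
    [X.Over (Spec (CommRingCat.of k))] {P : X} {e : X.presheaf.stalk P} {c : k} (hc : c ≠ 0)
    (he : e - algebraMap k _ c ∈ IsLocalRing.maximalIdeal (X.presheaf.stalk P)) : IsUnit e := by
  by_contra h
  have h1 := Ideal.sub_mem _ ((IsLocalRing.mem_maximalIdeal e).mpr h) he
  rw [sub_sub_cancel] at h1
  exact (IsLocalRing.mem_maximalIdeal _).mp h1 ((isUnit_iff_ne_zero.mpr hc).map _)

theorem evalAt_toFun {k : Type u} [Field k] {X : Scheme.{u}} [IsIntegral X]
    [X.Over (Spec (CommRingCat.of k))] {P : X} {g : X.presheaf.stalk P} {c : k}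
    (h : g - algebraMap k _ c ∈ IsLocalRing.maximalIdeal (X.presheaf.stalk P)) :
    evalAt k P (toFun P g) = c := by
  have H : ∃ c : k, ∃ g' : X.presheaf.stalk P, toFun P g' = toFun P g ∧
      g' - algebraMap k (X.presheaf.stalk P) c ∈
        IsLocalRing.maximalIdeal (X.presheaf.stalk P) := ⟨c, g, rfl, h⟩
  rw [evalAt, dif_pos H]
  obtain ⟨g', hg', hc⟩ := H.choose_spec
  rw [toFun_injective P hg'] at hc
  have h1 := Ideal.sub_mem _ h hc
  rw [sub_sub_sub_cancel_left, ← map_sub] at h1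
  by_contra hne
  exact (IsLocalRing.mem_maximalIdeal _).mp h1
    ((isUnit_iff_ne_zero.mpr (sub_ne_zero.mpr hne)).map _)

variable {k : Type u} [Field k] {X : Scheme.{u}} [IsIntegral X] [IsLocallyNoetherian X]

theorem divFun_prod {ι : Type*} (s : Finset ι) (f : ι → X.functionField) (hf : ∀ i ∈ s, f i ≠ 0)
    (Y : PrimeDivisor X) : divFun (∏ i ∈ s, f i) Y = ∑ i ∈ s, divFun (f i) Y := by
  classical
  induction s using Finset.induction_on with
  | empty => rw [Finset.prod_empty, Finset.sum_empty, divFun_one]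
  | insert i s hi ih =>
    rw [Finset.prod_insert hi, Finset.sum_insert hi, divFun_mul Y
      (hf i (Finset.mem_insert_self i s))
      (Finset.prod_ne_zero_iff.mpr fun j hj => hf j (Finset.mem_insert_of_mem hj)),
      ih fun j hj => hf j (Finset.mem_insert_of_mem hj)]

namespace LocalData

variable {r : ℕ} {D : Fin r → WeilDivisor X} {P : X} (L : LocalData D P)

theorem socle_mul_mem_powIdeal {m : X.presheaf.stalk P}
    (hm : m ∈ IsLocalRing.maximalIdeal (X.presheaf.stalk P)) : L.socle * m ∈ L.powIdeal := by
  classical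
  rw [← L.span_x] at hm
  induction hm using Submodule.span_induction with
  | mem y hy =>
    obtain ⟨i, rfl⟩ := hy
    rw [socle, ← Finset.mul_prod_erase _ _ (Finset.mem_univ i), mul_right_comm, ← pow_succ,
      Nat.sub_add_cancel L.a_pos]
    exact Ideal.mul_mem_right _ _ (Ideal.subset_span ⟨i, rfl⟩)
  | zero => rw [mul_zero]; exact zero_mem _
  | add y z _ _ hy hz => rw [mul_add]; exact add_mem hy hz
  | smul a y _ hy => rw [smul_eq_mul, mul_left_comm]; exact Ideal.mul_mem_left _ _ hy

theorem prod_f_ne_zero : toFun P (∏ j, L.f j) ≠ 0 := by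
  rw [map_prod]
  exact Finset.prod_ne_zero_iff.mpr fun j _ => (L.isLocalEquation_f j).1

theorem divFun_prod_f {Y : PrimeDivisor X} (hY : P ∈ closure {Y.1}) :
    divFun (toFun P (∏ j, L.f j)) Y = ∑ j, D j Y := by
  rw [map_prod, divFun_prod _ _ fun j _ => (L.isLocalEquation_f j).1]
  exact Finset.sum_congr rfl fun j _ => (L.isLocalEquation_f j).2 Y hY

variable [X.Over (Spec (CommRingCat.of k))]
  [SmoothOfRelativeDimension r (X ↘ Spec (CommRingCat.of k))]

theorem isCoordinates (hP : IsRationalPoint k P) : IsCoordinates k L.x := by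
  obtain ⟨y, b, -⟩ := exists_isCoordinates k r P
  exact exists_basis_eq_D b hP.surjective L.span_x

/-- The expansion coefficient at the socle monomial is determined by a congruence modulo
`(x₁ ^ a, …, x_r ^ a)`. -/
theorem expansionCoeff_eq (hP : IsRationalPoint k P) {h : X.presheaf.stalk P} {c : k}
    (hc : h - algebraMap k _ c * L.socle ∈ L.powIdeal) :
    expansionCoeff k L.x h (fun _ => L.a - 1) = c := by
  obtain ⟨y, b, -⟩ := exists_isCoordinates k r P
  obtain ⟨W, hPW, hW⟩ := exists_isChart (k := k) (r := r) P
  have := hW.formallySmooth_stalk hPW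
  have H : ∃ d : (Fin r → ℕ) → k, IsExpansion L.x h d := exists_expansion b hP L.span_x h
  rw [expansionCoeff, dif_pos H]
  exact coeff_expansion_eq b hP L.span_x H.choose_spec L.a_pos hc

/-- If `t` satisfies the rectifying congruence with constant `c` and `u` has value `d` at `P`, the
residue of `(f₁ ⋯ f_r)⁻¹ u t dx₁ ∧ ⋯ ∧ dx_r` is `c d`. -/
theorem residue_eq (hP : IsRationalPoint k P) {t u : X.presheaf.stalk P} {c d : k}
    (ht : L.R * t - algebraMap k _ c * L.socle ∈ L.powIdeal)
    (hu : u - algebraMap k _ d ∈ IsLocalRing.maximalIdeal (X.presheaf.stalk P))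
    {ω : RatForm k X r} (hω : toFun P (∏ j, L.f j) • ω =
      toFun P (u * t) • dWedge k fun i => toFun P (L.x i)) :
    L.residue ω = c * d := by
  have H : ∃ h : X.presheaf.stalk P,
      toFun P (∏ j, L.f j) • ω = toFun P h • dWedge k fun i => toFun P (L.x i) := ⟨_, hω⟩
  have h1 : H.choose = u * t := toFun_injective P
    (smul_left_injective _ (L.isCoordinates hP).dWedge_ne_zero (H.choose_spec.symm.trans hω))
  rw [residue, dif_pos H, h1]
  refine L.expansionCoeff_eq hP ?_
  have h2 := add_mem (Ideal.mul_mem_left _ u ht)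
    (Ideal.mul_mem_left _ (algebraMap k _ c) (L.socle_mul_mem_powIdeal hu))
  convert h2 using 1
  rw [map_mul]
  ring

/-- The socle monomial is not in `(x₁ ^ a, …, x_r ^ a)`. -/
theorem eq_zero_of_mul_socle_mem (hP : IsRationalPoint k P) {c : k}
    (hc : algebraMap k _ c * L.socle ∈ L.powIdeal) : c = 0 := by
  have h1 : expansionCoeff k L.x 0 (fun _ => L.a - 1) = c :=
    L.expansionCoeff_eq hP (by rw [zero_sub]; exact neg_mem hc)
  have h2 : expansionCoeff k L.x 0 (fun _ => L.a - 1) = (0 : k) :=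
    L.expansionCoeff_eq hP (by rw [map_zero, zero_mul, sub_zero]; exact zero_mem _)
  exact h1.symm.trans h2

end LocalData

theorem RectifyingCongr.ne_zero {r : ℕ} {D : Fin r → WeilDivisor X} {P : X}
    [X.Over (Spec (CommRingCat.of k))]
    [SmoothOfRelativeDimension r (X ↘ Spec (CommRingCat.of k))] (hP : IsRationalPoint k P)
    {θ : X.functionField} {c : k} (hc : c ≠ 0) (h : RectifyingCongr k D P θ c) : θ ≠ 0 := by
  rintro rfl
  obtain ⟨t, ht, H, hR⟩ := h
  rw [(map_eq_zero_iff _ (toFun_injective P)).mp ht, mul_zero, zero_sub, neg_mem_iff] at hR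
  exact hc ((fixedData D P H).eq_zero_of_mul_socle_mem hP hR)

end ResidueFormula

/-! ### The differential code as a functional code -/

section Main

variable {k : Type u} [Field k] {X : Scheme.{u}} [IsIntegral X]
  [X.Over (Spec (CommRingCat.of k))] {r n : ℕ}

theorem exists_ratForm_ne_zero [SmoothOfRelativeDimension r (X ↘ Spec (CommRingCat.of k))] :
    ∃ ω₀ : RatForm k X r, ω₀ ≠ 0 ∧
    ∀ ω : RatForm k X r, ∃ h : X.functionField, ω = h • ω₀ := by
  obtain ⟨x, hx⟩ := exists_isCoordinates k r (genericPoint X)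
  exact ⟨_, hx.dWedge_ne_zero, hx.exists_eq_smul⟩

/-- Every nonzero form generates the one-dimensional space of rational forms. -/
theorem exists_eq_smul_of_ne_zero
    [SmoothOfRelativeDimension r (X ↘ Spec (CommRingCat.of k))] {η : RatForm k X r}
    (hη : η ≠ 0) (ω : RatForm k X r) :
    ∃ h : X.functionField, ω = h • η := by
  obtain ⟨ω₀, -, h₀⟩ := exists_ratForm_ne_zero (k := k) (X := X) (r := r)
  obtain ⟨a, rfl⟩ := h₀ η
  obtain ⟨b, rfl⟩ := h₀ ω
  have ha : a ≠ 0 := by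
    rintro rfl
    exact hη (zero_smul _ _)
  exact ⟨b * a⁻¹, by rw [← mul_smul, mul_assoc, inv_mul_cancel₀ ha, mul_one]⟩

variable [IsLocallyNoetherian X]

theorem zero_mem_functionalCode (P : Fin n → X) (A : PrimeDivisor X → ℤ) :
    (0 : Fin n → k) ∈ functionalCode k P A :=
  ⟨0, Or.inl rfl, funext fun i => by
    simpa using evalAt_toFun (k := k) (P := P i) (g := 0) (c := 0) (by simp)⟩

variable [SmoothOfRelativeDimension r (X ↘ Spec (CommRingCat.of k))]

/-- There is a rational form which near each `P i` is a local form with poles exactly along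
`∑ D_l`, scaled to have residue one at `P i` after multiplication by `θ`. -/
theorem exists_form [TopologicalSpace.NoetherianSpace X] (hproj : IsProjective k X)
    {P : Fin n → X} (hinj : Function.Injective P) (hP : ∀ i, IsRationalPoint k (P i))
    {D : Fin r → WeilDivisor X} (L : ∀ i, LocalData D (P i)) {c : Fin n → k}
    (hc : ∀ i, c i ≠ 0) :
    ∃ η : RatForm k X r, η ≠ 0 ∧ ∀ i, ∃ e : X.presheaf.stalk (P i),
      e - algebraMap k _ (c i) ∈ IsLocalRing.maximalIdeal _ ∧
      toFun (P i) (∏ j, (L i).f j) • η =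
        toFun (P i) e • dWedge k fun j => toFun (P i) ((L i).x j) := by
  obtain ⟨ω₀, hω₀, h₀⟩ := exists_ratForm_ne_zero (k := k) (X := X) (r := r)
  have hcoord : ∀ i, IsCoordinates k (L i).x := fun i => (L i).isCoordinates (hP i)
  choose a ha using fun i => h₀ (dWedge k fun j => toFun (P i) ((L i).x j))
  have ha0 : ∀ i, a i ≠ 0 := by
    intro i h
    have h1 := ha i
    rw [h, zero_smul] at h1
    exact (hcoord i).dWedge_ne_zero h1
  have hF : ∀ i, toFun (P i) (∏ j, (L i).f j) ≠ 0 := fun i => (L i).prod_f_ne_zero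
  obtain ⟨W, hW, hPW⟩ := hproj.exists_isAffineOpen P fun i j hij h =>
    hij (hinj ((hP j).eq_of_specializes h)).symm
  have hdiv : ∀ i, ∀ Y : PrimeDivisor X, P i ∈ closure {Y.1} →
      divFun ((toFun (P i) (∏ j, (L i).f j))⁻¹ * a i) Y = -∑ j, D j Y - divForm ω₀ Y := by
    intro i Y hY
    have h1 := (hcoord i).divForm_dWedge hY
    rw [ha i, divForm_smul Y (ha0 i) hω₀] at h1
    rw [divFun_mul Y (inv_ne_zero (hF i)) (ha0 i), divFun_inv Y (hF i), (L i).divFun_prod_f hY]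
    omega
  obtain ⟨f, hf, he⟩ := exists_unit_mul_eq r hW hPW hP hinj
    (g := fun i => (toFun (P i) (∏ j, (L i).f j))⁻¹ * a i)
    (fun i => mul_ne_zero (inv_ne_zero (hF i)) (ha0 i))
    (fun i j Y hi hj => (hdiv i Y hi).trans (hdiv j Y hj).symm) hc
  refine ⟨f • ω₀, smul_ne_zero hf hω₀, fun i => ?_⟩
  obtain ⟨e, he, hfe⟩ := he i
  refine ⟨e, he, ?_⟩
  rw [ha i, ← mul_smul, ← mul_smul, hfe]
  congr 1
  have := hF i
  field_simp

end Main

end RectifiedCode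

end

theorem theorem5p2 {k : Type u} [Field k] [Finite k] {r n : ℕ}
    (X : Scheme.{u}) [X.Over (Spec (CommRingCat.of k))]
    [IsIntegral X] [IsLocallyNoetherian X]
    [GeometricallyIntegral (X ↘ Spec (CommRingCat.of k))]
    [SmoothOfRelativeDimension r (X ↘ Spec (CommRingCat.of k))]
    (hproj : RectifiedCode.IsProjective k X)
    (P : Fin n → X) (hPinj : Function.Injective P)
    (hPrat : ∀ i, RectifiedCode.IsRationalPoint k (P i))
    (D : Fin r → RectifiedCode.WeilDivisor X) (hDeff : ∀ l, 0 ≤ D l)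
    (hDproper : (RectifiedCode.interSupp D).Finite)
    (hPD : ∀ i, P i ∈ RectifiedCode.interSupp D)
    (G : RectifiedCode.WeilDivisor X) (hG : ∀ i, P i ∉ RectifiedCode.supp G)
    (θ : X.functionField) (hθ : RectifiedCode.IsStrictlyRectifying k D P θ) :
    (∃ G' : RectifiedCode.WeilDivisor X, (∀ i, P i ∉ RectifiedCode.supp G') ∧
      RectifiedCode.differentialCode k D P θ G = RectifiedCode.functionalCode k P G') ∧
    ∀ U : X.Opens, (∀ i, P i ∈ U) →
      ∃ V : X.Opens, V ≤ U ∧ (∀ i, P i ∈ V) ∧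
      ∃ η : RectifiedCode.RatForm k X r, η ≠ 0 ∧
        (∀ Y : RectifiedCode.PrimeDivisor X, Y.1 ∈ V →
          RectifiedCode.divForm η Y = -∑ l, D l Y) ∧
        (∀ i, RectifiedCode.res D (P i) (θ • η) = 1) ∧
        ∃ A : RectifiedCode.WeilDivisor X,
          (∀ Y, A Y = ∑ l, D l Y - G Y + RectifiedCode.divForm η Y
            - (RectifiedCode.divFun θ Y)⁻) ∧
          (∀ i, P i ∉ RectifiedCode.supp A) ∧
          RectifiedCode.differentialCode k D P θ G = RectifiedCode.functionalCode k P A := by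
  open RectifiedCode in
  classical
  have := hproj.compactSpace
  have : IsNoetherian X := { }
  have : TopologicalSpace.NoetherianSpace X := inferInstance
  refine (and_iff_right_of_imp fun h => ?_).mpr ?_
  · obtain ⟨-, -, -, η, -, -, -, A, -, hA, hcode⟩ := h ⊤ fun _ => trivial
    exact ⟨A, hA, hcode⟩
  choose c hc0 t ht H hR using hθ.congr_mem
  let L : ∀ i, LocalData D (P i) := fun i => fixedData D (P i) (H i)
  obtain ⟨η, hη, he⟩ := exists_form hproj hPinj hPrat L fun i => inv_ne_zero (hc0 i)
  choose e he hηe using he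
  have heu : ∀ i, IsUnit (e i) := fun i =>
    isUnit_of_sub_algebraMap_mem (inv_ne_zero (hc0 i)) (he i)
  have hdiv : ∀ i, ∀ Y : PrimeDivisor X, P i ∈ closure {Y.1} →
      divForm η Y = -∑ l, D l Y := by
    intro i Y hY
    have hcoord := (L i).isCoordinates (hPrat i)
    have he0 : toFun (P i) (e i) ≠ 0 := fun h =>
      (heu i).ne_zero ((map_eq_zero_iff _ (toFun_injective (P i))).mp h)
    have h1 := congrArg (fun ω => divForm ω Y) (hηe i)
    beta_reduce at h1
    rw [divForm_smul Y (L i).prod_f_ne_zero hη, (L i).divFun_prod_f hY,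
      divForm_smul Y he0 hcoord.dWedge_ne_zero, hcoord.divForm_dWedge hY,
      divFun_of_isUnit_of_mem_closure (heu i) hY] at h1
    omega
  -- the residue at `P i` of a multiple of `θ η` is the value of the multiplier
  have hres : ∀ i (g : X.presheaf.stalk (P i)),
      res D (P i) ((toFun (P i) g * θ) • η) = evalAt k (P i) (toFun (P i) g) := by
    intro i g
    obtain ⟨b, hb⟩ := exists_sub_algebraMap_mem_maximalIdeal (hPrat i).surjective g
    rw [evalAt_toFun hb, res, dif_pos (H i)]
    have hge : g * e i - algebraMap k _ (b * (c i)⁻¹) ∈ IsLocalRing.maximalIdeal _ := by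
      have h1 := add_mem (Ideal.mul_mem_left _ g (he i))
        (Ideal.mul_mem_right (algebraMap k _ (c i)⁻¹) _ hb)
      convert h1 using 1
      rw [map_mul]
      ring
    rw [(L i).residue_eq (hPrat i) (hR i) hge, mul_comm, mul_assoc, inv_mul_cancel₀ (hc0 i),
      mul_one]
    rw [smul_comm, hηe i, ← mul_smul, map_mul, map_mul, ht i]
    congr 1
    ring
  intro U hU
  -- `V` avoids the prime divisors along which `η` does not have the required order
  have hbad : {Y : PrimeDivisor X | divForm η Y ≠ -∑ l, D l Y}.Finite := by
    refine ((finite_divForm_ne_zero η).union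
      (Set.finite_iUnion fun l => (D l).hasFiniteSupport)).subset fun Y hY => ?_
    by_contra hcon
    simp only [Set.mem_union, Set.mem_ofPred_eq, Set.mem_iUnion, Function.mem_support, not_or,
      not_exists, not_not] at hcon
    refine hY ?_
    rw [hcon.1, Finset.sum_eq_zero fun l _ => hcon.2 l, neg_zero]
  let V : X.Opens := U ⊓ ⟨(⋃ Y ∈ {Y : PrimeDivisor X | divForm η Y ≠ -∑ l, D l Y}, closure {Y.1})ᶜ,
    (hbad.isClosed_biUnion fun _ _ => isClosed_closure).isOpen_compl⟩
  refine ⟨V, inf_le_left, fun i => ⟨hU i, ?_⟩, η, hη, fun Y hY => ?_, fun i => ?_, ?_⟩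
  · intro h
    obtain ⟨Y, hY, hPY⟩ := Set.mem_iUnion₂.mp h
    exact hY (hdiv i Y hPY)
  · by_contra hne
    exact hY.2 (Set.mem_iUnion₂.mpr ⟨Y, hne, subset_closure rfl⟩)
  · have h1 := hres i 1
    rw [map_one, one_mul] at h1
    rw [h1, ← map_one (toFun (P i))]
    exact evalAt_toFun (by rw [map_one, sub_self]; exact zero_mem _)
  have hAfin : (Function.support fun Y => ∑ l, D l Y - G Y + divForm η Y
      - (divFun θ Y)⁻).Finite := by
    refine (((hbad.union G.hasFiniteSupport).union (finite_divFun_ne_zero θ))).subset fun Y hY => ?_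
    by_contra hcon
    simp only [Set.mem_union, Set.mem_ofPred_eq, Function.mem_support, not_or, not_not] at hcon
    refine hY ?_
    simp only [hcon.1.1, hcon.1.2, hcon.2, negPart_zero]
    ring
  let A : WeilDivisor X := Finsupp.ofSupportFinite _ hAfin
  have hA : ∀ Y, A Y = ∑ l, D l Y - G Y + divForm η Y - (divFun θ Y)⁻ := fun Y => rfl
  have hAP : ∀ i, ∀ Y : PrimeDivisor X, P i ∈ closure {Y.1} → A Y = 0 := by
    intro i Y hY
    have h1 : G Y = 0 := by
      by_contra h
      exact hG i ⟨Y, h, hY⟩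
    have h2 : (divFun θ Y)⁻ = 0 := negPart_eq_zero.mpr <| divFun_nonneg_of_isRegularAt Y <|
      IsRegularAt.of_specializes (specializes_iff_mem_closure.mpr hY) ⟨t i, ht i⟩
    rw [hA, hdiv i Y hY, h1, h2]
    ring
  refine ⟨A, hA, ?_, ?_⟩
  · rintro i ⟨Y, hY, hPY⟩
    exact hY (hAP i Y hPY)
  -- a function in `L(A)` is regular at each `P i` because `A` avoids `P i`
  have hLreg : ∀ f ∈ LSpace (X := X) A, ∀ i, IsRegularAt (P i) f := by
    intro f hf i
    rcases hf with rfl | hf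
    · exact ⟨0, map_zero _⟩
    refine isRegularAt_of_forall_divFun_nonneg k r (P i) fun Y hY => ?_
    have h1 := hf Y
    rw [Pi.add_apply, hAP i Y hY, add_zero] at h1
    exact h1
  have hcode : ∀ f ∈ LSpace (X := X) A,
      (fun i => res (k := k) D (P i) ((f * θ) • η)) = fun i => evalAt k (P i) f := by
    intro f hf
    funext i
    obtain ⟨g, rfl⟩ := hLreg f hf i
    exact hres i g
  by_cases hθ0 : θ = 0
  · -- a rectifying function vanishes only if there are no points, and then `k ^ n` is a point
    have : IsEmpty (Fin n) := ⟨fun i =>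
      RectifyingCongr.ne_zero (hPrat i) (hc0 i) ⟨t i, ht i, H i, hR i⟩ hθ0⟩
    have h1 : (0 : Fin n → k) ∈ differentialCode k D P θ G :=
      ⟨0, Or.inl rfl, Subsingleton.elim _ _⟩
    exact Set.Subset.antisymm (fun v _ => Subsingleton.elim 0 v ▸ zero_mem_functionalCode P A)
      fun v _ => Subsingleton.elim 0 v ▸ h1
  -- every form is `f θ η` for some `f`, and `(θ) - (θ)⁺ = -(θ)⁻` turns the one space into the other
  have hspace : ∀ f : X.functionField, (f * θ) • η ∈ OmegaSpace k r
      (fun Y => ∑ l, D l Y - G Y - (divFun θ Y)⁺) ↔ f ∈ LSpace (X := X) A := by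
    intro f
    by_cases hf : f = 0
    · rw [hf, zero_mul, zero_smul]
      exact ⟨fun _ => Or.inl rfl, fun _ => Or.inl rfl⟩
    refine or_congr ⟨fun h => absurd h (smul_ne_zero (mul_ne_zero hf hθ0) hη),
      fun h => absurd h hf⟩ (forall_congr' fun Y => ?_)
    have h1 := posPart_sub_negPart (divFun θ Y)
    simp only [Pi.zero_apply, Pi.add_apply]
    rw [divForm_smul Y (mul_ne_zero hf hθ0) hη, divFun_mul Y hf hθ0, hA]
    constructor <;> intro h <;> linarith
  refine Set.Subset.antisymm ?_ ?_
  · rintro _ ⟨ω, hω, rfl⟩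
    obtain ⟨h, rfl⟩ := exists_eq_smul_of_ne_zero hη ω
    rw [← div_mul_cancel₀ h hθ0] at hω ⊢
    have hf := (hspace _).mp hω
    exact ⟨_, hf, (hcode _ hf).symm⟩
  · rintro _ ⟨f, hf, rfl⟩
    exact ⟨_, (hspace f).mpr hf, hcode f hf⟩
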